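/- Let $\Bbbk$ be a field and $X$ a linearly ordered set. Algebras are not assumed to be unital. A $\mathrm{GD}^!$-algebra is a $\Bbbk$-vector space with two bilinear operations $*$ and $\star$ such that $*$ is associative and commutative and $$(x\star y)\star z-x\star(y\star z)=(x\star z)\star y-x\star(z\star y),\qquad x\star(y\star z)=y\star(x\star z),$$ $$x\star(y*z)=(x\star y)*z,\qquad x\star(y*z)+y\star(x*z)=(x*y)\star z.$$ A differential $\mathrm{BiCom}$-algebra is a $\Bbbk$-vector space with two associative and commutative bilinear operations $*$ and $\odot$ satisfying $(x\odot y)*z=x\odot(y*z)$, together with a linear map $d$ that is a derivation relative to both operations. Every such algebra becomes a $\mathrm{GD}^!$-algebra under $*$ and $x\star y=d(x)\odot y$. A $\mathrm{GD}^!$-algebra is called special if it embeds into a $\mathrm{GD}^!$-algebra obtained in this way, and $\mathrm{SGD}^!$ is the variety of all homomorphic images of special $\mathrm{GD}^!$-algebras. Let $\mathrm{GD}^!\langle X\rangle$ be the free $\mathrm{GD}^!$-algebra and $\mathrm{BiComDer}\langle X,d\rangle$ the free differential $\mathrm{BiCom}$-algebra generated by $X$, and let $\mathrm{SGD}^!\langle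 X\rangle\subset \mathrm{BiComDer}\langle X,d\rangle$ be the subspace generated by $X$ under the operations $*$ and $x\star y=d(x)\odot y$. Define the weight of a differential monomial by $\mathrm{wt}(x)=-1$ for $x\in X$, $\mathrm{wt}(d(u))=\mathrm{wt}(u)+1$, $\mathrm{wt}(u*v)=\mathrm{wt}(u)+\mathrm{wt}(v)+1$, $\mathrm{wt}(u\odot v)=\mathrm{wt}(u)+\mathrm{wt}(v)$. Theorem. 1. $\mathrm{SGD}^!\langle X\rangle$ is the free algebra of the variety $\mathrm{SGD}^!$ generated by $X$. 2. There is an isomorphism of $\mathrm{GD}^!$-algebras $\mathrm{GD}^!\langle X\rangle\to\mathrm{SGD}^!\langle X\rangle$ that sends each $x\in X$ to $x$. 3. In particular, the monomials $$x_1*\dots*x_t*\bigl(y_1\odot\dots\odot y_i\odot d^{r_{i+1}}(y_{i+1})\odot\dots\odot d^{r_k}(y_k)\bigr),$$ with $t\ge 0$, $k\ge 1$, $0\le i\le k$, $x_j,y_j\in X$, $x_1\le\dots\le x_t\le y_1\le\dots\le y_i$, $r_{i+1},\dots,r_k>0$, $r_{i+1}+\dots+r_k-k=-1$, and $(r_{i+1},y_{i+1})\le\dots\le(r_k,y_k)$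 lexicographically, all have weight $-1$, and they form a linear basis of $\mathrm{GD}^!\langle X\rangle$ (identified with $\mathrm{SGD}^!\langle X\rangle$ by this isomorphism; monomials with different data are different elements). -/

import Mathlib

/-! Dual Gelfand-Dorfman algebras, differential BiCom-algebras, the free algebras of both
varieties, and the special dual Gelfand-Dorfman algebra generated by a set. Algebras are not
assumed to be unital. -/

namespace GelfandDorfman

section Algebras

variable {𝕜 A B : Type*} [Field 𝕜] [AddCommGroup A] [Module 𝕜 A] [AddCommGroup B] [Module 𝕜 B]

/-- `(A, ∗, ⋆)` is a dual Gelfand-Dorfman algebra: `ast x y` is `x ∗ y`, `nov x y` is `x ⋆ y`. -/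
structure IsGDDual (ast nov : A →ₗ[𝕜] A →ₗ[𝕜] A) : Prop where
  ast_comm : ∀ x y, ast x y = ast y x
  ast_assoc : ∀ x y z, ast x (ast y z) = ast (ast x y) z
  nov_right_symm : ∀ x y z,
    nov (nov x y) z - nov x (nov y z) = nov (nov x z) y - nov x (nov z y)
  nov_left_comm : ∀ x y z, nov x (nov y z) = nov y (nov x z)
  nov_ast : ∀ x y z, nov x (ast y z) = ast (nov x y) z
  nov_ast_add : ∀ x y z, nov x (ast y z) + nov y (ast x z) = nov (ast x y) z

/-- `(A, ∗, ⊙, d)` is a differential BiCom-algebra: `∗` and `⊙` are associative and commutative,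
`(x ⊙ y) ∗ z = x ⊙ (y ∗ z)`, and `d` is a derivation with respect to both products. -/
structure IsDiffBiCom (ast odot : A →ₗ[𝕜] A →ₗ[𝕜] A) (d : A →ₗ[𝕜] A) : Prop where
  ast_comm : ∀ x y, ast x y = ast y x
  ast_assoc : ∀ x y z, ast x (ast y z) = ast (ast x y) z
  odot_comm : ∀ x y, odot x y = odot y x
  odot_assoc : ∀ x y z, odot x (odot y z) = odot (odot x y) z
  mixed : ∀ x y z, ast (odot x y) z = odot x (ast y z)
  d_ast : ∀ x y, d (ast x y) = ast (d x) y + ast x (d y)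
  d_odot : ∀ x y, d (odot x y) = odot (d x) y + odot x (d y)

/-- The operation `x ⋆ y = d(x) ⊙ y`. -/
def derivedNov (odot : A →ₗ[𝕜] A →ₗ[𝕜] A) (d : A →ₗ[𝕜] A) : A →ₗ[𝕜] A →ₗ[𝕜] A :=
  odot.comp d

/-- Homomorphisms of systems with two bilinear operations. -/
structure IsHom (ast nov : A →ₗ[𝕜] A →ₗ[𝕜] A) (ast' nov' : B →ₗ[𝕜] B →ₗ[𝕜] B)
    (f : A →ₗ[𝕜] B) : Prop where
  map_ast : ∀ x y, f (ast x y) = ast' (f x) (f y)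
  map_nov : ∀ x y, f (nov x y) = nov' (f x) (f y)

end Algebras

section Special

universe u v

variable {𝕜 : Type u} [Field 𝕜] {A : Type v} [AddCommGroup A] [Module 𝕜 A]

/-- A dual Gelfand-Dorfman algebra is special if it embeds into a differential BiCom-algebra `C`
with respect to the operations `x ∗ y` and `x ⋆ y = d(x) ⊙ y` on `C`. -/
def IsSpecial (ast nov : A →ₗ[𝕜] A →ₗ[𝕜] A) : Prop :=
  IsGDDual ast nov ∧
  ∃ (C : Type v) (_ : AddCommGroup C) (_ : Module 𝕜 C)
    (astC odotC : C →ₗ[𝕜] C →ₗ[𝕜] C) (dC : C →ₗ[𝕜] C) (j : A →ₗ[𝕜] C),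
    IsDiffBiCom astC odotC dC ∧ Function.Injective j ∧
      IsHom ast nov astC (derivedNov odotC dC) j

/-- The variety generated by the special dual Gelfand-Dorfman algebras: all homomorphic images
of special algebras. -/
def IsSGDDual (ast nov : A →ₗ[𝕜] A →ₗ[𝕜] A) : Prop :=
  ∃ (S : Type v) (_ : AddCommGroup S) (_ : Module 𝕜 S)
    (astS novS : S →ₗ[𝕜] S →ₗ[𝕜] S) (p : S →ₗ[𝕜] A),
    IsSpecial astS novS ∧ Function.Surjective p ∧ IsHom astS novS ast nov p

end Special

section Constructions

variable {𝕜 : Type*} [Field 𝕜]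

/-- The bilinear extension of a binary operation on monomials. -/
noncomputable def extendOp {T : Type*} (op : T → T → T) :
    (T →₀ 𝕜) →ₗ[𝕜] (T →₀ 𝕜) →ₗ[𝕜] (T →₀ 𝕜) :=
  Finsupp.linearCombination 𝕜 fun s => Finsupp.lmapDomain 𝕜 𝕜 (op s)

/-- The linear extension of a unary operation on monomials. -/
noncomputable def extendUnary {T : Type*} (op : T → T) : (T →₀ 𝕜) →ₗ[𝕜] (T →₀ 𝕜) :=
  Finsupp.lmapDomain 𝕜 𝕜 op

variable {M : Type*} [AddCommGroup M] [Module 𝕜 M]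

theorem map_mem_span_of_forall {R : M → Prop} (f : M →ₗ[𝕜] M) (h : ∀ a, R a → R (f a)) :
    ∀ a ∈ Submodule.span 𝕜 {a | R a}, f a ∈ Submodule.span 𝕜 {a | R a} := by
  intro a ha
  have : Submodule.span 𝕜 {a | R a} ≤ (Submodule.span 𝕜 {a | R a}).comap f :=
    Submodule.span_le.2 fun x hx => Submodule.subset_span (h x hx)
  exact this ha

/-- A linear operation induced on the quotient by the subspace spanned by `R`. -/
def quotUnary (R : M → Prop) (f : M →ₗ[𝕜] M) (h : ∀ a, R a → R (f a)) :
    (M ⧸ Submodule.span 𝕜 {a | R a}) →ₗ[𝕜] (M ⧸ Submodule.span 𝕜 {a | R a}) :=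
  (Submodule.span 𝕜 {a | R a}).mapQ (Submodule.span 𝕜 {a | R a}) f
    (map_mem_span_of_forall f h)

/-- A bilinear operation induced on the quotient by the subspace spanned by `R`. -/
def quotOp (R : M → Prop) (b : M →ₗ[𝕜] M →ₗ[𝕜] M)
    (hl : ∀ c a, R a → R (b c a)) (hr : ∀ c a, R a → R (b a c)) :
    (M ⧸ Submodule.span 𝕜 {a | R a}) →ₗ[𝕜] (M ⧸ Submodule.span 𝕜 {a | R a}) →ₗ[𝕜]
      (M ⧸ Submodule.span 𝕜 {a | R a}) :=
  (Submodule.span 𝕜 {a | R a}).liftQ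
    { toFun := fun a => quotUnary R (b a) (hl a)
      map_add' := fun a a' => by
        ext x
        simp [quotUnary]
      map_smul' := fun r a => by
        ext x
        simp [quotUnary] }
    (fun a ha => by
      rw [LinearMap.mem_ker]
      ext x
      simpa [quotUnary] using map_mem_span_of_forall (b.flip x) (hr x) a ha)

/-- A bilinear operation restricted to a subspace closed under it. -/
def restrictOp (S : Submodule 𝕜 M) (b : M →ₗ[𝕜] M →ₗ[𝕜] M)
    (h : ∀ x ∈ S, ∀ y ∈ S, b x y ∈ S) : S →ₗ[𝕜] S →ₗ[𝕜] S :=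
  LinearMap.mk₂ 𝕜 (fun x y => ⟨b x y, h x x.2 y y.2⟩)
    (fun x x' y => by ext; simp) (fun r x y => by ext; simp)
    (fun x y y' => by ext; simp) (fun r x y => by ext; simp)

end Constructions

/-! ### The free dual Gelfand-Dorfman algebra -/

/-- Nonassociative monomials in `X` for two binary operations `∗` and `⋆`. -/
inductive GDTerm (X : Type*) where
  | var (x : X) : GDTerm X
  | ast (s t : GDTerm X) : GDTerm X
  | nov (s t : GDTerm X) : GDTerm X

section FreeGDDual

variable (𝕜 X : Type*) [Field 𝕜]

local notation:70 a:70 " ∗ " b:71 => extendOp GDTerm.ast a b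
local notation:70 a:70 " ⋆ " b:71 => extendOp GDTerm.nov a b

/-- The values of the defining identities of dual Gelfand-Dorfman algebras in the free
nonassociative algebra, together with all their multiples. -/
inductive GDRel : (GDTerm X →₀ 𝕜) → Prop
  | ast_comm (x y) : GDRel (x ∗ y - y ∗ x)
  | ast_assoc (x y z) : GDRel (x ∗ (y ∗ z) - (x ∗ y) ∗ z)
  | nov_right_symm (x y z) :
      GDRel (((x ⋆ y) ⋆ z - x ⋆ (y ⋆ z)) - ((x ⋆ z) ⋆ y - x ⋆ (z ⋆ y)))
  | nov_left_comm (x y z) : GDRel (x ⋆ (y ⋆ z) - y ⋆ (x ⋆ z))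
  | nov_ast (x y z) : GDRel (x ⋆ (y ∗ z) - (x ⋆ y) ∗ z)
  | nov_ast_add (x y z) : GDRel (x ⋆ (y ∗ z) + y ⋆ (x ∗ z) - (x ∗ y) ⋆ z)
  | ast_left (c) {a} : GDRel a → GDRel (c ∗ a)
  | ast_right (c) {a} : GDRel a → GDRel (a ∗ c)
  | nov_left (c) {a} : GDRel a → GDRel (c ⋆ a)
  | nov_right (c) {a} : GDRel a → GDRel (a ⋆ c)

/-- The ideal of the free nonassociative algebra generated by the defining identities. -/
noncomputable def gdIdeal : Submodule 𝕜 (GDTerm X →₀ 𝕜) := Submodule.span 𝕜 {a | GDRel 𝕜 X a}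

/-- The free dual Gelfand-Dorfman algebra generated by `X`. -/
abbrev FreeGDDual : Type _ := (GDTerm X →₀ 𝕜) ⧸ gdIdeal 𝕜 X

end FreeGDDual

namespace FreeGDDual

variable {𝕜 X : Type*} [Field 𝕜]

/-- The canonical generators. -/
noncomputable def ι (x : X) : FreeGDDual 𝕜 X :=
  (gdIdeal 𝕜 X).mkQ (Finsupp.single (GDTerm.var x) 1)

/-- The product `∗`. -/
noncomputable def ast : FreeGDDual 𝕜 X →ₗ[𝕜] FreeGDDual 𝕜 X →ₗ[𝕜] FreeGDDual 𝕜 X :=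
  quotOp (GDRel 𝕜 X) (extendOp GDTerm.ast) (fun c _ h => .ast_left c h)
    (fun c _ h => .ast_right c h)

/-- The product `⋆`. -/
noncomputable def nov : FreeGDDual 𝕜 X →ₗ[𝕜] FreeGDDual 𝕜 X →ₗ[𝕜] FreeGDDual 𝕜 X :=
  quotOp (GDRel 𝕜 X) (extendOp GDTerm.nov) (fun c _ h => .nov_left c h)
    (fun c _ h => .nov_right c h)

end FreeGDDual

/-! ### The free differential BiCom-algebra -/

/-- Nonassociative differential monomials in `X` for two binary operations `∗` and `⊙` and a
unary operation `d`. -/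
inductive DBTerm (X : Type*) where
  | var (x : X) : DBTerm X
  | d (s : DBTerm X) : DBTerm X
  | ast (s t : DBTerm X) : DBTerm X
  | odot (s t : DBTerm X) : DBTerm X

/-- The weight of a differential monomial. -/
def DBTerm.weight {X : Type*} : DBTerm X → ℤ
  | .var _ => -1
  | .d s => s.weight + 1
  | .ast s t => s.weight + t.weight + 1
  | .odot s t => s.weight + t.weight

section FreeDiffBiCom

variable (𝕜 X : Type*) [Field 𝕜]

local notation:70 a:70 " ∗ " b:71 => extendOp DBTerm.ast a b
local notation:70 a:70 " ⊙ " b:71 => extendOp DBTerm.odot a b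
local notation:max "∂" a:max => extendUnary DBTerm.d a

/-- The values of the defining identities of differential BiCom-algebras in the free
nonassociative algebra with a unary linear operation `d`, together with all their consequences
under the operations. -/
inductive DBRel : (DBTerm X →₀ 𝕜) → Prop
  | ast_comm (x y) : DBRel (x ∗ y - y ∗ x)
  | ast_assoc (x y z) : DBRel (x ∗ (y ∗ z) - (x ∗ y) ∗ z)
  | odot_comm (x y) : DBRel (x ⊙ y - y ⊙ x)
  | odot_assoc (x y z) : DBRel (x ⊙ (y ⊙ z) - (x ⊙ y) ⊙ z)
  | mixed (x y z) : DBRel ((x ⊙ y) ∗ z - x ⊙ (y ∗ z))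
  | d_ast (x y) : DBRel (∂ (x ∗ y) - (∂ x ∗ y + x ∗ ∂ y))
  | d_odot (x y) : DBRel (∂ (x ⊙ y) - (∂ x ⊙ y + x ⊙ ∂ y))
  | ast_left (c) {a} : DBRel a → DBRel (c ∗ a)
  | ast_right (c) {a} : DBRel a → DBRel (a ∗ c)
  | odot_left (c) {a} : DBRel a → DBRel (c ⊙ a)
  | odot_right (c) {a} : DBRel a → DBRel (a ⊙ c)
  | d_apply {a} : DBRel a → DBRel (∂ a)

/-- The `d`-invariant ideal generated by the defining identities. -/
noncomputable def dbIdeal : Submodule 𝕜 (DBTerm X →₀ 𝕜) := Submodule.span 𝕜 {a | DBRel 𝕜 X a}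

/-- The free differential BiCom-algebra generated by `X`. -/
abbrev FreeDiffBiCom : Type _ := (DBTerm X →₀ 𝕜) ⧸ dbIdeal 𝕜 X

end FreeDiffBiCom

namespace FreeDiffBiCom

variable {𝕜 X : Type*} [Field 𝕜]

variable (𝕜) in
/-- The element of the free differential BiCom-algebra represented by a monomial. -/
noncomputable def ofTerm (t : DBTerm X) : FreeDiffBiCom 𝕜 X :=
  (dbIdeal 𝕜 X).mkQ (Finsupp.single t 1)

/-- The canonical generators. -/
noncomputable def ι (x : X) : FreeDiffBiCom 𝕜 X := ofTerm 𝕜 (DBTerm.var x)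

/-- The product `∗`. -/
noncomputable def ast :
    FreeDiffBiCom 𝕜 X →ₗ[𝕜] FreeDiffBiCom 𝕜 X →ₗ[𝕜] FreeDiffBiCom 𝕜 X :=
  quotOp (DBRel 𝕜 X) (extendOp DBTerm.ast) (fun c _ h => .ast_left c h)
    (fun c _ h => .ast_right c h)

/-- The product `⊙`. -/
noncomputable def odot :
    FreeDiffBiCom 𝕜 X →ₗ[𝕜] FreeDiffBiCom 𝕜 X →ₗ[𝕜] FreeDiffBiCom 𝕜 X :=
  quotOp (DBRel 𝕜 X) (extendOp DBTerm.odot) (fun c _ h => .odot_left c h)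
    (fun c _ h => .odot_right c h)

/-- The derivation `d`. -/
noncomputable def d : FreeDiffBiCom 𝕜 X →ₗ[𝕜] FreeDiffBiCom 𝕜 X :=
  quotUnary (DBRel 𝕜 X) (extendUnary DBTerm.d) fun _ h => .d_apply h

/-- The operation `x ⋆ y = d(x) ⊙ y`. -/
noncomputable def nov :
    FreeDiffBiCom 𝕜 X →ₗ[𝕜] FreeDiffBiCom 𝕜 X →ₗ[𝕜] FreeDiffBiCom 𝕜 X :=
  derivedNov odot d

end FreeDiffBiCom

/-! ### The free special dual Gelfand-Dorfman algebra -/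

section SGDDual

variable (𝕜 X : Type*) [Field 𝕜]

/-- The subalgebra of the free differential BiCom-algebra generated by `X` relative to the
operations `∗` and `x ⋆ y = d(x) ⊙ y`: the intersection of all subspaces containing `X` and
closed under both operations. -/
noncomputable def SGDDual : Submodule 𝕜 (FreeDiffBiCom 𝕜 X) :=
  sInf {S | (∀ x : X, FreeDiffBiCom.ι x ∈ S) ∧
    (∀ a ∈ S, ∀ b ∈ S, FreeDiffBiCom.ast a b ∈ S) ∧
    (∀ a ∈ S, ∀ b ∈ S, FreeDiffBiCom.nov a b ∈ S)}

end SGDDual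

namespace SGDDual

variable {𝕜 X : Type*} [Field 𝕜]

/-- The canonical generators. -/
noncomputable def ι (x : X) : SGDDual 𝕜 X :=
  ⟨FreeDiffBiCom.ι x, Submodule.mem_sInf.2 fun _ hS => hS.1 x⟩

/-- The product `∗`. -/
noncomputable def ast : SGDDual 𝕜 X →ₗ[𝕜] SGDDual 𝕜 X →ₗ[𝕜] SGDDual 𝕜 X :=
  restrictOp (SGDDual 𝕜 X) FreeDiffBiCom.ast fun a ha b hb => Submodule.mem_sInf.2 fun S hS =>
    hS.2.1 a (Submodule.mem_sInf.1 ha S hS) b (Submodule.mem_sInf.1 hb S hS)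

/-- The product `⋆`. -/
noncomputable def nov : SGDDual 𝕜 X →ₗ[𝕜] SGDDual 𝕜 X →ₗ[𝕜] SGDDual 𝕜 X :=
  restrictOp (SGDDual 𝕜 X) FreeDiffBiCom.nov fun a ha b hb => Submodule.mem_sInf.2 fun S hS =>
    hS.2.2 a (Submodule.mem_sInf.1 ha S hS) b (Submodule.mem_sInf.1 hb S hS)

end SGDDual

/-! ### Basic monomials -/

/-- The data of a monomial
`x₁ ∗ ⋯ ∗ x_t ∗ (y₁ ⊙ ⋯ ⊙ y_i ⊙ d^{r_{i+1}}(y_{i+1}) ⊙ ⋯ ⊙ d^{r_k}(y_k))`: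
`xs = [x₁, …, x_t]`, `ys = [y₁, …, y_i]`, `zs = [(r_{i+1}, y_{i+1}), …, (r_k, y_k)]`. -/
@[ext]
structure BasicMonomial (X : Type*) [LinearOrder X] where
  xs : List X
  ys : List X
  zs : List (ℕ ×ₗ X)
  /-- `x₁ ≤ ⋯ ≤ x_t ≤ y₁ ≤ ⋯ ≤ y_i` -/
  sorted : (xs ++ ys).Pairwise (· ≤ ·)
  /-- `r_j > 0` for `j > i` -/
  pos : ∀ p ∈ zs, 0 < (ofLex p).1
  /-- the pairs `(r_j, y_j)` increase lexicographically -/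
  sorted_lex : zs.Pairwise (· ≤ ·)
  /-- `r_{i+1} + ⋯ + r_k - k = -1` -/
  sum_eq : ((zs.map fun p => ((ofLex p).1 : ℤ)).sum) - ((ys.length + zs.length : ℕ) : ℤ) = -1

namespace BasicMonomial

variable {X : Type*} [LinearOrder X]

/-- The list `y₁, …, y_i, d^{r_{i+1}}(y_{i+1}), …, d^{r_k}(y_k)`. -/
def factors (m : BasicMonomial X) : List (DBTerm X) :=
  m.ys.map DBTerm.var ++ m.zs.map fun p => DBTerm.d^[(ofLex p).1] (DBTerm.var (ofLex p).2)

theorem factors_ne_nil (m : BasicMonomial X) : m.factors ≠ [] := by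
  intro h
  obtain ⟨h1, h2⟩ := List.append_eq_nil_iff.1 h
  have := m.sum_eq
  rw [List.map_eq_nil_iff.1 h1, List.map_eq_nil_iff.1 h2] at this
  simp at this

/-- The product `y₁ ⊙ (y₂ ⊙ ⋯)` of a nonempty list. -/
def odotProd : (l : List (DBTerm X)) → l ≠ [] → DBTerm X
  | [], h => absurd rfl h
  | [s], _ => s
  | s :: t :: l, _ => DBTerm.odot s (odotProd (t :: l) (List.cons_ne_nil t l))

/-- The monomial itself. -/
def toTerm (m : BasicMonomial X) : DBTerm X :=
  m.xs.foldr (fun x w => DBTerm.ast (DBTerm.var x) w) (odotProd m.factors m.factors_ne_nil)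

end BasicMonomial

end GelfandDorfman

/-! In a dual Gelfand-Dorfman algebra all left multiplications, by `∗` and by `⋆`, commute, and
right symmetry passes from them to every operator of the commutative algebra `multAlg` that they
generate (`multAlg_comm`, `multAlg_right_symm`). This is enough to build, with no derivation and no
product `⊙` at hand, symmetric functions that behave like d^r(x) ⊙ y₁ ⊙ ⋯ ⊙ y_r: the Leibniz rule is
solved for its first term, d(a) ⊙ y ⊙ w = d(a ⊙ y) ⊙ w - d(y) ⊙ (a ⊙ w), and the right-hand side
makes sense by recursion (`listDeriv`).

Composing these functions with each other and with `∗`, and feeding in generators, gives the normal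
elements. Neither the order of the letters (`compLetters_perm`) nor the order of the generators
(`isMult_compLetters`) matters, so a normal element is the value of a basic monomial. The span of
the normal elements is closed under both products (`ast_mem_normalSpan`, `nov_mem_normalSpan`),
hence the basic monomials span the free dual Gelfand-Dorfman algebra.

For independence, the polynomial algebra in the variables d^r(x), with both `∗` and `⊙` equal to
multiplication, is a differential BiCom-algebra. Basic monomials are sent to monomials there, and to
distinct ones, because the weight condition tells how many of the underived letters belong to the
`⊙`-part (`content_injective`).

The canonical surjection onto `SGDDual` therefore carries a spanning family to an independent one,
so it is an isomorphism and the family is a basis. Homomorphic images of special algebras satisfy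
the dual Gelfand-Dorfman identities, so the universal property transfers along the isomorphism. -/

namespace GelfandDorfman

/-! ### Commuting left multiplications -/

section Operators

variable {𝕜 A : Type*} [Field 𝕜] [AddCommGroup A] [Module 𝕜 A] {ast nov : A →ₗ[𝕜] A →ₗ[𝕜] A}

/-- The algebra of operators generated by all left multiplications. -/
def multAlg (ast nov : A →ₗ[𝕜] A →ₗ[𝕜] A) : Subalgebra 𝕜 (Module.End 𝕜 A) :=
  Algebra.adjoin 𝕜 (Set.range ast ∪ Set.range nov)

theorem ast_mem_multAlg (ast nov : A →ₗ[𝕜] A →ₗ[𝕜] A) (a : A) : ast a ∈ multAlg ast nov :=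
  Algebra.subset_adjoin (Or.inl ⟨a, rfl⟩)

theorem nov_mem_multAlg (ast nov : A →ₗ[𝕜] A →ₗ[𝕜] A) (a : A) : nov a ∈ multAlg ast nov :=
  Algebra.subset_adjoin (Or.inr ⟨a, rfl⟩)

namespace IsGDDual

theorem nov_ast_comm (h : IsGDDual ast nov) (x y z : A) :
    nov x (ast y z) = ast y (nov x z) := by
  rw [h.ast_comm y z, h.nov_ast, h.ast_comm]

/-- The generating multiplications commute pairwise by associativity and commutativity of `∗`,
`nov_ast_comm` and left commutativity of `⋆`. Below, this is what lets an operator be pulled out of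
an argument. -/
theorem multAlg_comm (h : IsGDDual ast nov) {u v : Module.End 𝕜 A} (hu : u ∈ multAlg ast nov)
    (hv : v ∈ multAlg ast nov) (z : A) : u (v z) = v (u z) := by
  have key : ∀ a ∈ Set.range ast ∪ Set.range nov, ∀ b ∈ Set.range ast ∪ Set.range nov,
      Commute (S := Module.End 𝕜 A) a b := by
    rintro _ (⟨x, rfl⟩ | ⟨x, rfl⟩) _ (⟨y, rfl⟩ | ⟨y, rfl⟩) <;>
      refine LinearMap.ext fun z => ?_
    · change ast x (ast y z) = ast y (ast x z)
      rw [h.ast_assoc, h.ast_comm x y, ← h.ast_assoc]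
    · exact (h.nov_ast_comm y x z).symm
    · exact h.nov_ast_comm x y z
    · exact h.nov_left_comm x y z
  have hc : Commute u v :=
    Algebra.commute_of_mem_adjoin_of_forall_mem_commute hv fun b hb =>
      (Algebra.commute_of_mem_adjoin_of_forall_mem_commute hu fun a ha => key b hb a ha).symm
  exact LinearMap.congr_fun hc z

/-- Right symmetry extends from left multiplications to all operators of `multAlg`. -/
theorem multAlg_right_symm (h : IsGDDual ast nov) {u : Module.End 𝕜 A}
    (hu : u ∈ multAlg ast nov) :
    ∀ y z, nov (u y) z - nov y (u z) = nov (u z) y - nov z (u y) := by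
  refine Algebra.adjoin_induction (fun x hx => ?_) (fun r y z => ?_)
    (fun u v _ _ h1 h2 y z => ?_) (fun u v hu hv h1 h2 y z => ?_) hu
  · rcases hx with ⟨x, rfl⟩ | ⟨x, rfl⟩ <;> intro y z
    -- For `u = ast x`, the last axiom turns each side into `nov x` applied to the product of `y`
    -- and `z`, which is symmetric.
    · rw [← h.nov_ast_add, ← h.nov_ast_add, h.nov_ast_comm z x y, h.nov_ast_comm y x z,
        h.ast_comm z y]
      abel
    · have := h.nov_right_symm x y z
      rw [h.nov_left_comm y x z, h.nov_left_comm z x y]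
      exact this
  · simp only [Module.algebraMap_end_apply, map_smul, LinearMap.smul_apply]
    abel
  · have e1 := h1 y z
    have e2 := h2 y z
    simp only [LinearMap.add_apply, map_add] at e1 e2 ⊢
    grind
  -- The identity for `u` at `(v y, z)` minus the identity for `v` at `(u z, y)`: the mixed terms in
  -- `v y` and `u z` cancel, and `u`, `v` commute.
  · have e1 := h1 (v y) z
    have e2 := h2 (u z) y
    simp only [Module.End.mul_apply]
    rw [h.multAlg_comm hu hv z]
    grind

end IsGDDual

end Operators

/-! ### Symmetric functions of several arguments, their derivatives and compositions -/

section ListFunctions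

variable {𝕜 A : Type*} [Field 𝕜] [AddCommGroup A] [Module 𝕜 A] {ast nov : A →ₗ[𝕜] A →ₗ[𝕜] A}

/-- A function of lists is multiplicative if it does not depend on the order of the entries and
each entry is acted upon by an operator of `multAlg`. -/
structure IsMult (ast nov : A →ₗ[𝕜] A →ₗ[𝕜] A) (f : List A → A) : Prop where
  perm : ∀ {l l' : List A}, l.Perm l' → f l = f l'
  exists_op : ∀ l, ∃ u ∈ multAlg ast nov, ∀ z, f (z :: l) = u z

theorem perm_invariant_of_swap {α β : Type*} {f : List α → β}
    (hcons : ∀ y l l', l.Perm l' → f (y :: l) = f (y :: l'))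
    (hswap : ∀ y z l, f (y :: z :: l) = f (z :: y :: l)) {l l' : List α} (h : l.Perm l') :
    f l = f l' := by
  induction h with
  | nil => rfl
  | cons y h => exact hcons y _ _ h
  | swap y z l => exact hswap z y l
  | trans _ _ h1 h2 => exact h1.trans h2

namespace IsMult

theorem cons {f : List A → A} (hf : IsMult ast nov f) (y : A) :
    IsMult ast nov fun l => f (y :: l) where
  perm h := hf.perm (h.cons y)
  exists_op l := by
    obtain ⟨u, hu, h⟩ := hf.exists_op (y :: l)
    exact ⟨u, hu, fun z => (hf.perm (List.Perm.swap z y l)).trans (h z)⟩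

theorem exists_op_append {f : List A → A} (hf : IsMult ast nov f) (l : List A) :
    ∃ u ∈ multAlg ast nov, ∀ z, f (l ++ [z]) = u z := by
  obtain ⟨u, hu, h⟩ := hf.exists_op l
  exact ⟨u, hu, fun z => (hf.perm (List.perm_append_singleton z l)).trans (h z)⟩

theorem map_op (h : IsGDDual ast nov) {f : List A → A} (hf : IsMult ast nov f)
    {u : Module.End 𝕜 A} (hu : u ∈ multAlg ast nov) (z : A) (l : List A) :
    f (u z :: l) = u (f (z :: l)) := by
  obtain ⟨v, hv, hfv⟩ := hf.exists_op l
  rw [hfv, hfv, h.multAlg_comm hv hu]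

theorem cons_zero {f : List A → A} (hf : IsMult ast nov f) (l : List A) : f (0 :: l) = 0 := by
  obtain ⟨v, hv, hfv⟩ := hf.exists_op l
  rw [hfv, map_zero]

end IsMult

/-- The function with value `x` on the empty list and zero elsewhere. -/
def single0 (x : A) : List A → A
  | [] => x
  | _ => 0

/-- The identity on one-element lists, zero elsewhere. -/
def single1 : List A → A
  | [x] => x
  | _ => 0

/-- The product `∗` on two-element lists, zero elsewhere. -/
def astFun (ast : A →ₗ[𝕜] A →ₗ[𝕜] A) : List A → A
  | [x, y] => ast x y
  | _ => 0

/-- The derivative of a function of lists: if `f [y₁, …, y_k]` stands for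
`a ⊙ y₁ ⊙ ⋯ ⊙ y_k` then `listDeriv nov f [y₁, …, y_{k+1}]` stands for
`d(a) ⊙ y₁ ⊙ ⋯ ⊙ y_{k+1}`. -/
def listDeriv (nov : A →ₗ[𝕜] A →ₗ[𝕜] A) : (List A → A) → List A → A
  | _, [] => 0
  | f, [z] => nov (f []) z
  | f, y :: z :: l => listDeriv nov (fun l' => f (y :: l')) (z :: l) - nov y (f (z :: l))

/-- The composition of a function of `k + 1` arguments with another function. -/
def listComp : ℕ → (List A → A) → (List A → A) → List A → A
  | 0, f, g, l => f [g l]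
  | _ + 1, _, _, [] => 0
  | k + 1, f, g, y :: l => listComp k (fun l' => f (y :: l')) g l

theorem isMult_single0 (ast nov : A →ₗ[𝕜] A →ₗ[𝕜] A) (x : A) :
    IsMult ast nov (single0 x) where
  perm h := perm_invariant_of_swap (fun _ _ _ _ => rfl) (fun _ _ _ => rfl) h
  exists_op _ := ⟨0, zero_mem _, fun _ => rfl⟩

theorem isMult_single1 (ast nov : A →ₗ[𝕜] A →ₗ[𝕜] A) : IsMult ast nov (single1 (A := A)) where
  perm h := perm_invariant_of_swap
    (fun y l l' h => by
      rcases l with _ | ⟨z, l⟩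
      · rw [h.nil_eq]
      · rcases l' with _ | ⟨z', l'⟩
        · exact absurd h.symm.nil_eq (by simp)
        · rfl)
    (fun _ _ _ => rfl) h
  exists_op l := by
    rcases l with _ | ⟨z, l⟩
    · exact ⟨1, one_mem _, fun z => rfl⟩
    · exact ⟨0, zero_mem _, fun z => rfl⟩

theorem IsGDDual.isMult_astFun (h : IsGDDual ast nov) : IsMult ast nov (astFun ast) where
  perm hl := perm_invariant_of_swap
    (fun y l l' hl => by
      rcases l with _ | ⟨z, _ | ⟨w, l⟩⟩
      · rw [hl.nil_eq]
      · rw [List.singleton_perm.1 hl]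
      · have := hl.length_eq
        rcases l' with _ | ⟨z', _ | ⟨w', l'⟩⟩
        · simp at this
        · simp at this
        · rfl)
    (fun y z l => by
      rcases l with _ | ⟨w, l⟩
      · exact h.ast_comm y z
      · rfl) hl
  exists_op l := by
    rcases l with _ | ⟨y, _ | ⟨w, l⟩⟩
    · exact ⟨0, zero_mem _, fun z => rfl⟩
    · exact ⟨ast y, ast_mem_multAlg ast nov y, fun z => h.ast_comm z y⟩
    · exact ⟨0, zero_mem _, fun z => rfl⟩

theorem listDeriv_cons_perm {f : List A → A} (hf : IsMult ast nov f) (y : A) {l l' : List A}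
    (hl : l.Perm l')
    (hD : listDeriv nov (fun l' => f (y :: l')) l = listDeriv nov (fun l' => f (y :: l')) l') :
    listDeriv nov f (y :: l) = listDeriv nov f (y :: l') := by
  rcases l with _ | ⟨z, l⟩
  · rw [hl.nil_eq]
  · rcases l' with _ | ⟨z', l'⟩
    · exact absurd hl.symm.nil_eq (by simp)
    · rw [listDeriv, listDeriv, hD, hf.perm hl]

/-- The recursion singles out the first argument, so symmetry of the derivative has to be proved. It
uses the algebra's identities only on two arguments, where it is right symmetry for the operator `z
↦ f [z]`. -/
theorem IsGDDual.listDeriv_swap (h : IsGDDual ast nov) {f : List A → A}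
    (hf : IsMult ast nov f) (y z : A) (l : List A) :
    listDeriv nov f (y :: z :: l) = listDeriv nov f (z :: y :: l) := by
  rcases l with _ | ⟨w, l⟩
  · obtain ⟨u, hu, hfu⟩ := hf.exists_op []
    simp only [listDeriv, hfu]
    exact h.multAlg_right_symm hu y z
  -- With a third argument present, unfolding twice gives a derivative of `f (y :: z :: ·)` minus
  -- one term for each of `y` and `z`, visibly symmetric.
  · have e : (fun l' => f (y :: z :: l')) = fun l' => f (z :: y :: l') :=
      funext fun l' => hf.perm (List.Perm.swap z y l')
    simp only [listDeriv, e]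
    abel

theorem IsGDDual.listDeriv_perm (h : IsGDDual ast nov) {l l' : List A} (hl : l.Perm l') :
    ∀ {f : List A → A}, IsMult ast nov f → listDeriv nov f l = listDeriv nov f l' := by
  induction hl with
  | nil => exact fun _ => rfl
  | cons y hl ih => exact fun hf => listDeriv_cons_perm hf y hl (ih (hf.cons y))
  | swap y z l => exact fun hf => h.listDeriv_swap hf z y l
  | trans _ _ h1 h2 => exact fun hf => (h1 hf).trans (h2 hf)

theorem IsGDDual.isMult_listDeriv (h : IsGDDual ast nov) {f : List A → A}
    (hf : IsMult ast nov f) : IsMult ast nov (listDeriv nov f) where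
  perm hl := h.listDeriv_perm hl hf
  exists_op l := by
    induction l generalizing f with
    | nil => exact ⟨nov (f []), nov_mem_multAlg ast nov _, fun z => rfl⟩
    | cons y l ih =>
      obtain ⟨u, hu, h1⟩ := ih (hf.cons y)
      obtain ⟨v, hv, h2⟩ := hf.exists_op l
      -- After moving `y` to the front, the varying argument `z` sits inside both terms of the
      -- recursion; `u` and `v` are their dependence on it.
      refine ⟨u - nov y * v, sub_mem hu (mul_mem (nov_mem_multAlg ast nov y) hv), fun z => ?_⟩
      rw [h.listDeriv_swap hf, listDeriv, h1, h2]
      rfl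

/-- Expansion of `d(f(l)) ⊙ q` by the Leibniz rule. -/
theorem nov_sub_listDeriv_append_mem (S : Submodule 𝕜 A) (l : List A) (q : A) :
    ∀ f : List A → A, (∀ l1 y l2, l = l1 ++ y :: l2 → nov y (f (l1 ++ l2 ++ [q])) ∈ S) →
      nov (f l) q - listDeriv nov f (l ++ [q]) ∈ S := by
  induction l with
  | nil => intro f _; simp [listDeriv]
  | cons y l ih =>
    intro f hS
    have e : listDeriv nov f (y :: l ++ [q]) =
        listDeriv nov (fun l' => f (y :: l')) (l ++ [q]) - nov y (f (l ++ [q])) := by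
      rcases l with _ | ⟨z, l⟩ <;> rfl
    rw [e, ← sub_add]
    exact add_mem (ih (fun l' => f (y :: l')) fun l1 z l2 hl => hS (y :: l1) z l2 (by rw [hl]; rfl)) (hS [] y l rfl)

theorem listComp_eq_of_le (k : ℕ) : ∀ (f g : List A → A) (l l' : List A), l.length = k →
    listComp k f g (l ++ l') = f (l ++ [g l']) := by
  induction k with
  | zero => intro f g l l' hl; rw [List.length_eq_zero_iff.1 hl]; rfl
  | succ k ih =>
    rintro f g (_ | ⟨y, l⟩) l' hl
    · simp at hl
    · exact ih (fun l' => f (y :: l')) g l l' (by simpa using hl)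

theorem IsGDDual.isMult_listComp (h : IsGDDual ast nov) {g : List A → A}
    (hg : IsMult ast nov g) (k : ℕ) :
    ∀ {f : List A → A}, IsMult ast nov f → IsMult ast nov (listComp k f g) := by
  induction k with
  | zero =>
    refine fun {f} hf => ⟨fun hl => by simp only [listComp, hg.perm hl], fun l => ?_⟩
    obtain ⟨u, hu, h1⟩ := hf.exists_op []
    obtain ⟨v, hv, h2⟩ := hg.exists_op l
    exact ⟨u * v, mul_mem hu hv, fun z => by rw [listComp, h2, h1]; rfl⟩
  | succ k ih =>
    intro f hf
    have swap : ∀ y z l, listComp (k + 1) f g (y :: z :: l) = listComp (k + 1) f g (z :: y :: l) := by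
      intro y z l
      -- When `f` takes two arguments, one of `y`, `z` is inside `g`. There it enters through an
      -- operator `u` of `multAlg`, and `u` can be pulled out in front of `f`.
      rcases k with _ | k
      · obtain ⟨u, hu, hgu⟩ := hg.exists_op l
        simp only [listComp, hgu]
        rw [hf.perm (List.Perm.swap (u z) y []), hf.perm (List.Perm.swap (u y) z []),
          hf.map_op h hu, hf.map_op h hu, hf.perm (List.Perm.swap y z [])]
      · have e : (fun l' => f (y :: z :: l')) = fun l' => f (z :: y :: l') :=
          funext fun l' => hf.perm (List.Perm.swap z y l')
        simp only [listComp, e]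
    refine ⟨fun hl => perm_invariant_of_swap (fun y l l' hl => (ih (hf.cons y)).perm hl) swap hl,
      fun l => ?_⟩
    rcases l with _ | ⟨y, l⟩
    · rcases k with _ | k
      · obtain ⟨u, hu, h1⟩ := hf.exists_op [g []]
        exact ⟨u, hu, h1⟩
      · exact ⟨0, zero_mem _, fun z => rfl⟩
    · obtain ⟨u, hu, h1⟩ := (ih (hf.cons y)).exists_op l
      exact ⟨u, hu, fun z => (swap z y l).trans (h1 z)⟩

/-- The first argument of the composite may go to the inner function instead of the outer one, since
the composite is symmetric. -/
theorem IsGDDual.listComp_cons (h : IsGDDual ast nov) {H : List A → A}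
    (hH : IsMult ast nov H) (hH0 : H [] = 0) (m : ℕ) :
    ∀ {g : List A → A}, IsMult ast nov g → ∀ y l,
      listComp m g H (y :: l) = listComp m g (fun l' => H (y :: l')) l := by
  induction m with
  | zero => exact fun _ _ _ => rfl
  | succ m ih =>
    rintro g hg y (_ | ⟨z, l⟩)
    · rcases m with _ | m
      · change g [y, H []] = 0
        rw [hH0, hg.perm (List.Perm.swap 0 y []), hg.cons_zero]
      · rfl
    · rw [(h.isMult_listComp hH (m + 1) hg).perm (List.Perm.swap z y l)]
      exact ih (hg.cons z) y l

theorem IsGDDual.listComp_op (h : IsGDDual ast nov) {u : Module.End 𝕜 A}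
    (hu : u ∈ multAlg ast nov) (H : List A → A) (m : ℕ) :
    ∀ {g : List A → A}, IsMult ast nov g → ∀ l,
      listComp m g (fun l' => u (H l')) l = u (listComp m g H l) := by
  induction m with
  | zero => exact fun hg l => hg.map_op h hu _ _
  | succ m ih =>
    rintro g hg (_ | ⟨y, l⟩)
    · exact (map_zero u).symm
    · exact ih (hg.cons y) l

/-- Arguments are fed to `f` until it has only one left. It is then an operator of `multAlg`, which
passes through `g` by `listComp_op`. -/
theorem IsGDDual.listComp_left_comm (h : IsGDDual ast nov) {g H : List A → A}
    (hg : IsMult ast nov g) (hH : IsMult ast nov H) (m k : ℕ) :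
    ∀ {f : List A → A}, IsMult ast nov f →
      listComp k f (listComp m g H) = listComp m g (listComp k f H) := by
  induction k with
  | zero =>
    intro f hf
    obtain ⟨u, hu, h1⟩ := hf.exists_op []
    have e : ∀ K : List A → A, listComp 0 f K = fun l => u (K l) := fun K => funext fun l => h1 _
    rw [e, e]
    exact funext fun l => (h.listComp_op hu H m hg l).symm
  | succ k ih =>
    intro f hf
    funext l
    rcases l with _ | ⟨y, l⟩
    · rcases m with _ | m
      · exact (hg.cons_zero []).symm
      · rfl
    · rw [h.listComp_cons (h.isMult_listComp hH (k + 1) hf) rfl m hg]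
      exact congrFun (ih (hf.cons y)) l

end ListFunctions

/-! ### Normal elements and the closure of their span -/

section NormalElements

variable {𝕜 A X : Type*} [Field 𝕜] [AddCommGroup A] [Module 𝕜 A] {ast nov : A →ₗ[𝕜] A →ₗ[𝕜] A}
  {ι : X → A}

/-- The function `[y₁, …, y_{r + 1}] ↦ d^{r + 1}(x) ⊙ y₁ ⊙ ⋯ ⊙ y_{r + 1}` represented by the letter
`some (r, x)`; the letter `none` represents the product `∗`. -/
def letterFun (ast nov : A →ₗ[𝕜] A →ₗ[𝕜] A) (ι : X → A) : Option (ℕ × X) → List A → A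
  | none => astFun ast
  | some (r, x) => (listDeriv nov)^[r + 1] (single0 (ι x))

/-- One less than the number of arguments of a letter. -/
def letterDeg : Option (ℕ × X) → ℕ
  | none => 1
  | some (r, _) => r

/-- The composition of the functions represented by a list of letters. -/
def compLetters (ast nov : A →ₗ[𝕜] A →ₗ[𝕜] A) (ι : X → A) : List (Option (ℕ × X)) → List A → A
  | [] => single1
  | c :: cs => listComp (letterDeg c) (letterFun ast nov ι c) (compLetters ast nov ι cs)

/-- The elements obtained by applying a list of letters to a list of generators. -/
inductive IsNormal (ast nov : A →ₗ[𝕜] A →ₗ[𝕜] A) (ι : X → A) :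
    List (Option (ℕ × X)) → List X → A → Prop
  | gen (y : X) : IsNormal ast nov ι [] [y] (ι y)
  | letter (c : Option (ℕ × X)) (ys : List X) (hys : ys.length = letterDeg c) {cs ys' p} :
      IsNormal ast nov ι cs ys' p →
        IsNormal ast nov ι (c :: cs) (ys ++ ys') (letterFun ast nov ι c (ys.map ι ++ [p]))

theorem IsGDDual.isMult_letterFun (h : IsGDDual ast nov) (ι : X → A) (c : Option (ℕ × X)) :
    IsMult ast nov (letterFun ast nov ι c) := by
  have : ∀ (r : ℕ) (x : X), IsMult ast nov ((listDeriv nov)^[r] (single0 (ι x))) := by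
    intro r x
    induction r with
    | zero => exact isMult_single0 ast nov _
    | succ r ih => rw [Function.iterate_succ_apply']; exact h.isMult_listDeriv ih
  rcases c with _ | ⟨r, x⟩
  · exact h.isMult_astFun
  · exact this (r + 1) x

theorem letterFun_succ (r : ℕ) (x : X) : letterFun ast nov ι (some (r + 1, x)) =
    listDeriv nov (letterFun ast nov ι (some (r, x))) :=
  Function.iterate_succ_apply' _ _ _

theorem IsGDDual.isMult_compLetters (h : IsGDDual ast nov) (ι : X → A)
    (cs : List (Option (ℕ × X))) : IsMult ast nov (compLetters ast nov ι cs) := by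
  induction cs with
  | nil => exact isMult_single1 ast nov
  | cons c cs ih => exact h.isMult_listComp ih _ (h.isMult_letterFun ι c)

theorem IsGDDual.compLetters_perm (h : IsGDDual ast nov) (ι : X → A)
    {cs cs' : List (Option (ℕ × X))} (hcs : cs.Perm cs') :
    compLetters ast nov ι cs = compLetters ast nov ι cs' := by
  induction hcs with
  | nil => rfl
  | cons c _ ih => simp only [compLetters, ih]
  | swap c c' cs =>
    exact h.listComp_left_comm (h.isMult_letterFun ι c) (h.isMult_compLetters ι cs) _ _
      (h.isMult_letterFun ι c')
  | trans _ _ h1 h2 => exact h1.trans h2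

namespace IsNormal

theorem eq_compLetters {cs : List (Option (ℕ × X))} {ys : List X} {p : A}
    (hp : IsNormal ast nov ι cs ys p) : p = compLetters ast nov ι cs (ys.map ι) := by
  induction hp with
  | gen y => rfl
  | letter c ys hys _ ih =>
    rw [List.map_append, compLetters, listComp_eq_of_le _ _ _ _ _ (by simpa using hys), ← ih]

theorem length_eq {cs : List (Option (ℕ × X))} {ys : List X} {p : A}
    (hp : IsNormal ast nov ι cs ys p) : ys.length = (cs.map letterDeg).sum + 1 := by
  induction hp with
  | gen y => rfl
  | letter c ys hys _ ih => simp [ih, hys, add_assoc]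

end IsNormal

theorem isNormal_compLetters (ast nov : A →ₗ[𝕜] A →ₗ[𝕜] A) (ι : X → A)
    (cs : List (Option (ℕ × X))) (ys : List X) (hys : ys.length = (cs.map letterDeg).sum + 1) :
    IsNormal ast nov ι cs ys (compLetters ast nov ι cs (ys.map ι)) := by
  suffices ∃ p, IsNormal ast nov ι cs ys p by
    obtain ⟨p, hp⟩ := this
    exact hp.eq_compLetters ▸ hp
  induction cs generalizing ys with
  | nil =>
    obtain ⟨y, rfl⟩ := List.length_eq_one_iff.1 hys
    exact ⟨_, .gen y⟩
  | cons c cs ih =>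
    simp only [List.map_cons, List.sum_cons] at hys
    obtain ⟨p, hp⟩ := ih (ys.drop (letterDeg c)) (by rw [List.length_drop]; omega)
    have := IsNormal.letter c (ys.take (letterDeg c)) (by rw [List.length_take]; omega) hp
    rw [List.take_append_drop] at this
    exact ⟨_, this⟩

/-- The span of the normal elements. -/
def normalSpan (ast nov : A →ₗ[𝕜] A →ₗ[𝕜] A) (ι : X → A) : Submodule 𝕜 A :=
  Submodule.span 𝕜 {p | ∃ cs ys, IsNormal ast nov ι cs ys p}

theorem IsNormal.mem_normalSpan {cs : List (Option (ℕ × X))} {ys : List X} {p : A}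
    (hp : IsNormal ast nov ι cs ys p) : p ∈ normalSpan ast nov ι :=
  Submodule.subset_span ⟨cs, ys, hp⟩

theorem map_mem_normalSpan {u : Module.End 𝕜 A}
    (hu : ∀ cs ys p, IsNormal ast nov ι cs ys p → u p ∈ normalSpan ast nov ι) {q : A}
    (hq : q ∈ normalSpan ast nov ι) : u q ∈ normalSpan ast nov ι := by
  have : normalSpan ast nov ι ≤ (normalSpan ast nov ι).comap u :=
    Submodule.span_le.2 fun p ⟨cs, ys, hp⟩ => hu cs ys p hp
  exact this hq

namespace IsGDDual

theorem letterFun_mem_normalSpan (h : IsGDDual ast nov) (c : Option (ℕ × X)) (ys : List X)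
    (hys : ys.length = letterDeg c) {q : A} (hq : q ∈ normalSpan ast nov ι) :
    letterFun ast nov ι c (ys.map ι ++ [q]) ∈ normalSpan ast nov ι := by
  obtain ⟨u, -, hu⟩ := (h.isMult_letterFun ι c).exists_op_append (ys.map ι)
  rw [hu]
  refine map_mem_normalSpan (fun cs ys' p hp => ?_) hq
  rw [← hu]
  exact (hp.letter c ys hys).mem_normalSpan

theorem ast_gen_mem_normalSpan (h : IsGDDual ast nov) (y : X) {q : A}
    (hq : q ∈ normalSpan ast nov ι) : ast (ι y) q ∈ normalSpan ast nov ι :=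
  h.letterFun_mem_normalSpan none [y] rfl hq

theorem nov_gen_mem_normalSpan (h : IsGDDual ast nov) (y : X) {q : A}
    (hq : q ∈ normalSpan ast nov ι) : nov (ι y) q ∈ normalSpan ast nov ι :=
  h.letterFun_mem_normalSpan (some (0, y)) [] rfl hq

/-- A letter may have two non-generators among its arguments: by induction on `p`, the letters of
`p` act through operators of `multAlg` and move outside, until `p` is a generator. -/
theorem letterFun_mem_normalSpan₂ (h : IsGDDual ast nov) (c : Option (ℕ × X)) (ys : List X)
    (hys : ys.length + 1 = letterDeg c) {p q : A} (hp : p ∈ normalSpan ast nov ι)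
    (hq : q ∈ normalSpan ast nov ι) :
    letterFun ast nov ι c (p :: q :: ys.map ι) ∈ normalSpan ast nov ι := by
  have hc := h.isMult_letterFun ι c
  obtain ⟨u, hu, h1⟩ := hc.exists_op (q :: ys.map ι)
  rw [h1]
  refine map_mem_normalSpan (fun cs ys' p hp => ?_) hp
  induction hp with
  | gen y =>
    rw [← h1, hc.perm (l' := (y :: ys).map ι ++ [q])]
    · exact h.letterFun_mem_normalSpan c (y :: ys) hys hq
    · exact (List.perm_append_singleton q _).symm.cons (ι y)
  | letter c' ys' hys' _ ih =>
    obtain ⟨v, hv, h2⟩ := (h.isMult_letterFun ι c').exists_op_append (ys'.map ι)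
    rw [h2, h.multAlg_comm hu hv, ← h2]
    exact h.letterFun_mem_normalSpan c' ys' hys' ih

theorem ast_mem_normalSpan (h : IsGDDual ast nov) {p q : A} (hp : p ∈ normalSpan ast nov ι)
    (hq : q ∈ normalSpan ast nov ι) : ast p q ∈ normalSpan ast nov ι := by
  rw [h.ast_comm]
  refine map_mem_normalSpan (u := ast q) (fun cs ys p hp => ?_) hp
  induction hp with
  | gen y => rw [h.ast_comm]; exact h.ast_gen_mem_normalSpan y hq
  | letter c ys hys _ ih =>
    obtain ⟨v, hv, h2⟩ := (h.isMult_letterFun ι c).exists_op_append (ys.map ι)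
    rw [h2, h.multAlg_comm (ast_mem_multAlg ast nov q) hv, ← h2]
    exact h.letterFun_mem_normalSpan c ys hys ih

/-- The map `p ↦ nov p q` is a right multiplication, to which commutation does not apply. The
induction on `p` expands the derivative of its outermost letter instead. -/
theorem nov_mem_normalSpan (h : IsGDDual ast nov) {p q : A} (hp : p ∈ normalSpan ast nov ι)
    (hq : q ∈ normalSpan ast nov ι) : nov p q ∈ normalSpan ast nov ι := by
  refine map_mem_normalSpan (u := nov.flip q) (fun cs ys p hp => ?_) hp
  rw [LinearMap.flip_apply]
  induction hp with
  | gen y => exact h.nov_gen_mem_normalSpan y hq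
  | @letter c ys hys cs ys' p hp ih =>
    have hp' := hp.mem_normalSpan
    rcases c with _ | ⟨r, x⟩
    · obtain ⟨y, rfl⟩ := List.length_eq_one_iff.1 hys
      change nov (ast (ι y) p) q ∈ _
      -- This is d(y ∗ p) ⊙ q = y ⋆ (p ∗ q) + y ∗ (p ⋆ q).
      rw [← h.nov_ast_add, h.nov_ast_comm p]
      exact add_mem (h.nov_gen_mem_normalSpan y (h.ast_mem_normalSpan hp' hq))
        (h.ast_gen_mem_normalSpan y ih)
    · have hc := h.isMult_letterFun ι (some (r, x))
      obtain ⟨u, hu, h1⟩ := hc.exists_op_append (ys.map ι)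
      -- The main Leibniz term: the derivative falls on d^{r+1}(x), giving the next letter `some (r
      -- + 1, x)` with the two non-generators `p` and `q`.
      have hD : listDeriv nov (letterFun ast nov ι (some (r, x))) (ys.map ι ++ [p] ++ [q]) ∈
          normalSpan ast nov ι := by
        rw [← letterFun_succ, (h.isMult_letterFun ι _).perm (l' := p :: q :: ys.map ι)]
        · exact h.letterFun_mem_normalSpan₂ _ ys (by rw [hys]; rfl) hp' hq
        · rw [List.append_assoc]
          exact List.perm_append_comm
      rw [← sub_add_cancel (nov _ q) (listDeriv nov _ (ys.map ι ++ [p] ++ [q]))]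
      refine add_mem (nov_sub_listDeriv_append_mem _ _ _ _ fun l1 y l2 hl => ?_) hD
      -- The other Leibniz terms: the derivative falls on `p`, and the induction hypothesis for `nov
      -- p q` applies, or on one of the generators, and the letter then acts on `p`, `q` and the
      -- remaining generators.
      rcases List.eq_nil_or_concat l2 with rfl | ⟨l2, w, rfl⟩
      · obtain ⟨rfl, h3⟩ := List.append_inj' hl rfl
        obtain rfl : p = y := by simpa using h3
        rw [List.append_nil, h1, h.multAlg_comm (nov_mem_multAlg ast nov p) hu, ← h1]
        exact h.letterFun_mem_normalSpan _ ys hys ih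
      · rw [List.concat_eq_append, ← List.cons_append, ← List.append_assoc] at hl
        obtain ⟨h3, h4⟩ := List.append_inj' hl rfl
        obtain rfl : p = w := by simpa using h4
        obtain ⟨m1, m2, rfl, rfl, h5⟩ := List.map_eq_append_iff.1 h3
        obtain ⟨y, m2, rfl, rfl, rfl⟩ := List.map_eq_cons_iff.1 h5
        refine h.nov_gen_mem_normalSpan y ?_
        rw [hc.perm (l' := p :: q :: (m1 ++ m2).map ι)]
        · refine h.letterFun_mem_normalSpan₂ _ _ ?_ hp' hq
          rw [← hys]
          simp [add_assoc]
        · rw [List.concat_eq_append, ← List.append_assoc, List.append_assoc _ [p] [q],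
            List.map_append]
          exact List.perm_append_comm

end IsGDDual

end NormalElements

/-! ### Universal properties and passage between the varieties -/

section Lifts

variable {𝕜 A B X : Type*} [Field 𝕜] [AddCommGroup A] [Module 𝕜 A] [AddCommGroup B] [Module 𝕜 B]

theorem linearCombination_extendOp {T : Type*} (op : T → T → T) (b : A →ₗ[𝕜] A →ₗ[𝕜] A)
    (v : T → A) (hv : ∀ s t, v (op s t) = b (v s) (v t)) (x y : T →₀ 𝕜) :
    Finsupp.linearCombination 𝕜 v (extendOp op x y) =
      b (Finsupp.linearCombination 𝕜 v x) (Finsupp.linearCombination 𝕜 v y) := by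
  have : (extendOp op).compr₂ (Finsupp.linearCombination 𝕜 v) =
      b.compl₁₂ (Finsupp.linearCombination 𝕜 v) (Finsupp.linearCombination 𝕜 v) := by
    ext s t
    simp [extendOp, Finsupp.mapDomain_single, hv]
  exact LinearMap.congr_fun₂ this x y

theorem linearCombination_extendUnary {T : Type*} (op : T → T) (f : A →ₗ[𝕜] A)
    (v : T → A) (hv : ∀ s, v (op s) = f (v s)) (x : T →₀ 𝕜) :
    Finsupp.linearCombination 𝕜 v (extendUnary op x) = f (Finsupp.linearCombination 𝕜 v x) := by
  have : (Finsupp.linearCombination 𝕜 v).comp (extendUnary op) =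
      f.comp (Finsupp.linearCombination 𝕜 v) := by
    ext s
    simp [extendUnary, Finsupp.mapDomain_single, hv]
  exact LinearMap.congr_fun this x

theorem extendOp_single {T : Type*} (op : T → T → T) (s t : T) :
    extendOp (𝕜 := 𝕜) op (Finsupp.single s 1) (Finsupp.single t 1) = Finsupp.single (op s t) 1 := by
  simp [extendOp, Finsupp.mapDomain_single]

theorem extendUnary_single {T : Type*} (op : T → T) (s : T) :
    extendUnary (𝕜 := 𝕜) op (Finsupp.single s 1) = Finsupp.single (op s) 1 := by
  simp [extendUnary, Finsupp.mapDomain_single]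

/-- The value of a monomial in an algebra with two binary operations. -/
def GDTerm.eval (ast nov : A →ₗ[𝕜] A →ₗ[𝕜] A) (f : X → A) : GDTerm X → A
  | .var x => f x
  | .ast s t => ast (s.eval ast nov f) (t.eval ast nov f)
  | .nov s t => nov (s.eval ast nov f) (t.eval ast nov f)

/-- The value of a differential monomial. -/
def DBTerm.eval (ast odot : A →ₗ[𝕜] A →ₗ[𝕜] A) (d : A →ₗ[𝕜] A) (f : X → A) : DBTerm X → A
  | .var x => f x
  | .d s => d (s.eval ast odot d f)
  | .ast s t => ast (s.eval ast odot d f) (t.eval ast odot d f)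
  | .odot s t => odot (s.eval ast odot d f) (t.eval ast odot d f)

namespace FreeGDDual

theorem isGDDual : IsGDDual (ast (𝕜 := 𝕜) (X := X)) nov := by
  constructor
  · rintro ⟨x⟩ ⟨y⟩
    exact (Submodule.Quotient.eq _).2 (Submodule.subset_span (GDRel.ast_comm x y))
  · rintro ⟨x⟩ ⟨y⟩ ⟨z⟩
    exact (Submodule.Quotient.eq _).2 (Submodule.subset_span (GDRel.ast_assoc x y z))
  · rintro ⟨x⟩ ⟨y⟩ ⟨z⟩
    exact (Submodule.Quotient.eq _).2 (Submodule.subset_span (GDRel.nov_right_symm x y z))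
  · rintro ⟨x⟩ ⟨y⟩ ⟨z⟩
    exact (Submodule.Quotient.eq _).2 (Submodule.subset_span (GDRel.nov_left_comm x y z))
  · rintro ⟨x⟩ ⟨y⟩ ⟨z⟩
    exact (Submodule.Quotient.eq _).2 (Submodule.subset_span (GDRel.nov_ast x y z))
  · rintro ⟨x⟩ ⟨y⟩ ⟨z⟩
    exact (Submodule.Quotient.eq _).2 (Submodule.subset_span (GDRel.nov_ast_add x y z))

theorem eq_top_of_closed {S : Submodule 𝕜 (FreeGDDual 𝕜 X)} (hι : ∀ x, ι x ∈ S)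
    (hast : ∀ a ∈ S, ∀ b ∈ S, ast a b ∈ S) (hnov : ∀ a ∈ S, ∀ b ∈ S, nov a b ∈ S) : S = ⊤ := by
  have key : ∀ t : GDTerm X, (gdIdeal 𝕜 X).mkQ (Finsupp.single t 1) ∈ S := by
    intro t
    induction t with
    | var x => exact hι x
    | ast s t hs ht => rw [← extendOp_single]; exact hast _ hs _ ht
    | nov s t hs ht => rw [← extendOp_single]; exact hnov _ hs _ ht
  refine Submodule.eq_top_iff'.2 fun a => ?_
  obtain ⟨a, rfl⟩ := (gdIdeal 𝕜 X).mkQ_surjective a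
  induction a using Finsupp.induction_linear with
  | zero => exact zero_mem _
  | add a b ha hb => rw [map_add]; exact add_mem ha hb
  | single t c =>
    rw [← mul_one c, ← smul_eq_mul, ← Finsupp.smul_single, map_smul]
    exact S.smul_mem c (key t)

theorem linearCombination_eval_eq_zero {astA novA : A →ₗ[𝕜] A →ₗ[𝕜] A} (h : IsGDDual astA novA)
    (f : X → A) {a : GDTerm X →₀ 𝕜} (ha : GDRel 𝕜 X a) :
    Finsupp.linearCombination 𝕜 (GDTerm.eval astA novA f) a = 0 := by
  have h1 := linearCombination_extendOp GDTerm.ast astA (GDTerm.eval astA novA f)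
    (fun _ _ => rfl)
  have h2 := linearCombination_extendOp GDTerm.nov novA (GDTerm.eval astA novA f)
    (fun _ _ => rfl)
  induction ha with
  | ast_comm x y => rw [map_sub, h1, h1, h.ast_comm, sub_self]
  | ast_assoc x y z => simp only [map_sub, h1, h.ast_assoc, sub_self]
  | nov_right_symm x y z => simp only [map_sub, h2, sub_eq_zero]; exact h.nov_right_symm _ _ _
  | nov_left_comm x y z => simp only [map_sub, h2, sub_eq_zero]; exact h.nov_left_comm _ _ _
  | nov_ast x y z => simp only [map_sub, h1, h2, sub_eq_zero]; exact h.nov_ast _ _ _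
  | nov_ast_add x y z =>
    simp only [map_sub, map_add, h1, h2, sub_eq_zero]; exact h.nov_ast_add _ _ _
  | ast_left c _ ih => rw [h1, ih, map_zero]
  | ast_right c _ ih => rw [h1, ih, map_zero, LinearMap.zero_apply]
  | nov_left c _ ih => rw [h2, ih, map_zero]
  | nov_right c _ ih => rw [h2, ih, map_zero, LinearMap.zero_apply]

/-- The universal property of the free dual Gelfand-Dorfman algebra. -/
theorem exists_lift {astA novA : A →ₗ[𝕜] A →ₗ[𝕜] A} (h : IsGDDual astA novA) (f : X → A) :
    ∃ g : FreeGDDual 𝕜 X →ₗ[𝕜] A, IsHom ast nov astA novA g ∧ ∀ x, g (ι x) = f x := by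
  refine ⟨(gdIdeal 𝕜 X).liftQ (Finsupp.linearCombination 𝕜 (GDTerm.eval astA novA f))
    (Submodule.span_le.2 fun a ha => linearCombination_eval_eq_zero h f ha), ⟨?_, ?_⟩, fun x => ?_⟩
  · rintro ⟨x⟩ ⟨y⟩
    exact linearCombination_extendOp GDTerm.ast astA _ (fun _ _ => rfl) x y
  · rintro ⟨x⟩ ⟨y⟩
    exact linearCombination_extendOp GDTerm.nov novA _ (fun _ _ => rfl) x y
  · refine (Submodule.liftQ_apply _ _ _).trans ?_
    rw [Finsupp.linearCombination_single, one_smul]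
    rfl

end FreeGDDual

namespace FreeDiffBiCom

theorem isDiffBiCom : IsDiffBiCom (ast (𝕜 := 𝕜) (X := X)) odot d := by
  constructor
  · rintro ⟨x⟩ ⟨y⟩
    exact (Submodule.Quotient.eq _).2 (Submodule.subset_span (DBRel.ast_comm x y))
  · rintro ⟨x⟩ ⟨y⟩ ⟨z⟩
    exact (Submodule.Quotient.eq _).2 (Submodule.subset_span (DBRel.ast_assoc x y z))
  · rintro ⟨x⟩ ⟨y⟩
    exact (Submodule.Quotient.eq _).2 (Submodule.subset_span (DBRel.odot_comm x y))
  · rintro ⟨x⟩ ⟨y⟩ ⟨z⟩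
    exact (Submodule.Quotient.eq _).2 (Submodule.subset_span (DBRel.odot_assoc x y z))
  · rintro ⟨x⟩ ⟨y⟩ ⟨z⟩
    exact (Submodule.Quotient.eq _).2 (Submodule.subset_span (DBRel.mixed x y z))
  · rintro ⟨x⟩ ⟨y⟩
    exact (Submodule.Quotient.eq _).2 (Submodule.subset_span (DBRel.d_ast x y))
  · rintro ⟨x⟩ ⟨y⟩
    exact (Submodule.Quotient.eq _).2 (Submodule.subset_span (DBRel.d_odot x y))

theorem ofTerm_ast (s t : DBTerm X) : ofTerm 𝕜 (.ast s t) = ast (ofTerm 𝕜 s) (ofTerm 𝕜 t) := by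
  rw [ofTerm, ← extendOp_single]
  rfl

theorem ofTerm_odot (s t : DBTerm X) :
    ofTerm 𝕜 (.odot s t) = odot (ofTerm 𝕜 s) (ofTerm 𝕜 t) := by
  rw [ofTerm, ← extendOp_single]
  rfl

theorem ofTerm_d (s : DBTerm X) : ofTerm 𝕜 (.d s) = d (ofTerm 𝕜 s) := by
  rw [ofTerm, ← extendUnary_single]
  rfl

theorem linearCombination_eval_eq_zero {astA odotA : A →ₗ[𝕜] A →ₗ[𝕜] A} {dA : A →ₗ[𝕜] A}
    (h : IsDiffBiCom astA odotA dA) (f : X → A) {a : DBTerm X →₀ 𝕜} (ha : DBRel 𝕜 X a) :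
    Finsupp.linearCombination 𝕜 (DBTerm.eval astA odotA dA f) a = 0 := by
  have h1 := linearCombination_extendOp DBTerm.ast astA (DBTerm.eval astA odotA dA f)
    (fun _ _ => rfl)
  have h2 := linearCombination_extendOp DBTerm.odot odotA (DBTerm.eval astA odotA dA f)
    (fun _ _ => rfl)
  have h3 := linearCombination_extendUnary DBTerm.d dA (DBTerm.eval astA odotA dA f)
    (fun _ => rfl)
  induction ha with
  | ast_comm x y => rw [map_sub, h1, h1, h.ast_comm, sub_self]
  | ast_assoc x y z => simp only [map_sub, h1, h.ast_assoc, sub_self]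
  | odot_comm x y => rw [map_sub, h2, h2, h.odot_comm, sub_self]
  | odot_assoc x y z => simp only [map_sub, h2, h.odot_assoc, sub_self]
  | mixed x y z => simp only [map_sub, h1, h2, h.mixed, sub_self]
  | d_ast x y => simp only [map_sub, map_add, h1, h3, h.d_ast, sub_self]
  | d_odot x y => simp only [map_sub, map_add, h2, h3, h.d_odot, sub_self]
  | ast_left c _ ih => rw [h1, ih, map_zero]
  | ast_right c _ ih => rw [h1, ih, map_zero, LinearMap.zero_apply]
  | odot_left c _ ih => rw [h2, ih, map_zero]
  | odot_right c _ ih => rw [h2, ih, map_zero, LinearMap.zero_apply]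
  | d_apply _ ih => rw [h3, ih, map_zero]

theorem exists_lift {astA odotA : A →ₗ[𝕜] A →ₗ[𝕜] A} {dA : A →ₗ[𝕜] A}
    (h : IsDiffBiCom astA odotA dA) (f : X → A) :
    ∃ g : FreeDiffBiCom 𝕜 X →ₗ[𝕜] A, ∀ t, g (ofTerm 𝕜 t) = t.eval astA odotA dA f := by
  refine ⟨(dbIdeal 𝕜 X).liftQ (Finsupp.linearCombination 𝕜 (DBTerm.eval astA odotA dA f))
    (Submodule.span_le.2 fun a ha => linearCombination_eval_eq_zero h f ha), fun t => ?_⟩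
  refine (Submodule.liftQ_apply _ _ _).trans ?_
  rw [Finsupp.linearCombination_single, one_smul]

end FreeDiffBiCom

/-- A differential BiCom-algebra is a dual Gelfand-Dorfman algebra. -/
theorem IsDiffBiCom.isGDDual {ast odot : A →ₗ[𝕜] A →ₗ[𝕜] A} {d : A →ₗ[𝕜] A}
    (h : IsDiffBiCom ast odot d) : IsGDDual ast (derivedNov odot d) where
  ast_comm := h.ast_comm
  ast_assoc := h.ast_assoc
  nov_right_symm x y z := by
    simp only [derivedNov, LinearMap.comp_apply, h.d_odot, map_add, LinearMap.add_apply,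
      ← h.odot_assoc]
    rw [h.odot_comm y z]
    abel
  nov_left_comm x y z := by
    simp only [derivedNov, LinearMap.comp_apply, h.odot_assoc]
    rw [h.odot_comm (d x)]
  nov_ast x y z := (h.mixed _ _ _).symm
  nov_ast_add x y z := by
    -- The mixed law up to commutativity; with it, the two Leibniz terms of d(x ∗ y) ⊙ z are the two
    -- summands on the left.
    have key : ∀ a b c, odot (ast a b) c = odot a (ast b c) := fun a b c => by
      rw [h.odot_comm, ← h.mixed, h.odot_comm, h.mixed, h.ast_comm]
    simp only [derivedNov, LinearMap.comp_apply, h.d_ast, h.ast_comm x (d y), map_add,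
      LinearMap.add_apply, key]

theorem IsHom.isGDDual_of_injective {ast nov : A →ₗ[𝕜] A →ₗ[𝕜] A} {ast' nov' : B →ₗ[𝕜] B →ₗ[𝕜] B}
    {f : A →ₗ[𝕜] B} (hf : IsHom ast nov ast' nov' f) (hinj : Function.Injective f)
    (h : IsGDDual ast' nov') : IsGDDual ast nov where
  ast_comm x y := hinj (by simp only [hf.map_ast]; exact h.ast_comm _ _)
  ast_assoc x y z := hinj (by simp only [hf.map_ast]; exact h.ast_assoc _ _ _)
  nov_right_symm x y z :=
    hinj (by simp only [map_sub, hf.map_nov]; exact h.nov_right_symm _ _ _)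
  nov_left_comm x y z := hinj (by simp only [hf.map_nov]; exact h.nov_left_comm _ _ _)
  nov_ast x y z := hinj (by simp only [hf.map_ast, hf.map_nov]; exact h.nov_ast _ _ _)
  nov_ast_add x y z :=
    hinj (by simp only [map_add, hf.map_ast, hf.map_nov]; exact h.nov_ast_add _ _ _)

theorem IsHom.isGDDual_of_surjective {ast nov : A →ₗ[𝕜] A →ₗ[𝕜] A}
    {ast' nov' : B →ₗ[𝕜] B →ₗ[𝕜] B} {f : A →ₗ[𝕜] B} (hf : IsHom ast nov ast' nov' f)
    (hsurj : Function.Surjective f) (h : IsGDDual ast nov) : IsGDDual ast' nov' where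
  ast_comm := hsurj.forall₂.2 fun x y => by simp only [← hf.map_ast, h.ast_comm x y]
  ast_assoc := hsurj.forall₃.2 fun x y z => by simp only [← hf.map_ast, h.ast_assoc x y z]
  nov_right_symm := hsurj.forall₃.2 fun x y z => by
    simp only [← hf.map_nov, ← map_sub, h.nov_right_symm x y z]
  nov_left_comm := hsurj.forall₃.2 fun x y z => by
    simp only [← hf.map_nov, h.nov_left_comm x y z]
  nov_ast := hsurj.forall₃.2 fun x y z => by
    simp only [← hf.map_ast, ← hf.map_nov, h.nov_ast x y z]
  nov_ast_add := hsurj.forall₃.2 fun x y z => by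
    simp only [← hf.map_ast, ← hf.map_nov, ← map_add, h.nov_ast_add x y z]

theorem IsSGDDual.isGDDual {ast nov : A →ₗ[𝕜] A →ₗ[𝕜] A} (h : IsSGDDual ast nov) :
    IsGDDual ast nov := by
  obtain ⟨S, _, _, astS, novS, p, hS, hsurj, hp⟩ := h
  exact hp.isGDDual_of_surjective hsurj hS.1

namespace SGDDual

theorem isHom_subtype : IsHom (ast (𝕜 := 𝕜) (X := X)) nov FreeDiffBiCom.ast
    (derivedNov FreeDiffBiCom.odot FreeDiffBiCom.d) (SGDDual 𝕜 X).subtype :=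
  ⟨fun _ _ => rfl, fun _ _ => rfl⟩

theorem isGDDual : IsGDDual (ast (𝕜 := 𝕜) (X := X)) nov :=
  isHom_subtype.isGDDual_of_injective Subtype.val_injective FreeDiffBiCom.isDiffBiCom.isGDDual

theorem isSGDDual : IsSGDDual (ast (𝕜 := 𝕜) (X := X)) nov :=
  ⟨SGDDual 𝕜 X, inferInstance, inferInstance, ast, nov, LinearMap.id,
    ⟨isGDDual, FreeDiffBiCom 𝕜 X, inferInstance, inferInstance, FreeDiffBiCom.ast,
      FreeDiffBiCom.odot, FreeDiffBiCom.d, (SGDDual 𝕜 X).subtype, FreeDiffBiCom.isDiffBiCom,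
      Subtype.val_injective, isHom_subtype⟩,
    Function.surjective_id, ⟨fun _ _ => rfl, fun _ _ => rfl⟩⟩

theorem eq_top_of_closed {S : Submodule 𝕜 (SGDDual 𝕜 X)} (hι : ∀ x, ι x ∈ S)
    (hast : ∀ a ∈ S, ∀ b ∈ S, ast a b ∈ S) (hnov : ∀ a ∈ S, ∀ b ∈ S, nov a b ∈ S) : S = ⊤ := by
  have hle : SGDDual 𝕜 X ≤ S.map (SGDDual 𝕜 X).subtype := by
    refine sInf_le ⟨fun x => ⟨ι x, hι x, rfl⟩, ?_, ?_⟩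
    · rintro _ ⟨a, ha, rfl⟩ _ ⟨b, hb, rfl⟩
      exact ⟨ast a b, hast a ha b hb, rfl⟩
    · rintro _ ⟨a, ha, rfl⟩ _ ⟨b, hb, rfl⟩
      exact ⟨nov a b, hnov a ha b hb, rfl⟩
  refine Submodule.eq_top_iff'.2 fun a => ?_
  obtain ⟨b, hb, hab⟩ := hle a.2
  exact Subtype.val_injective hab ▸ hb

theorem hom_ext {astA novA : A →ₗ[𝕜] A →ₗ[𝕜] A} {g g' : SGDDual 𝕜 X →ₗ[𝕜] A}
    (hg : IsHom ast nov astA novA g) (hg' : IsHom ast nov astA novA g')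
    (h : ∀ x, g (ι x) = g' (ι x)) : g = g' :=
  LinearMap.eqLocus_eq_top.1 <| eq_top_of_closed h
    (fun a ha b hb => by
      rw [LinearMap.mem_eqLocus] at *
      rw [hg.map_ast, hg'.map_ast, ha, hb])
    (fun a ha b hb => by
      rw [LinearMap.mem_eqLocus] at *
      rw [hg.map_nov, hg'.map_nov, ha, hb])

end SGDDual

end Lifts

/-! ### Normal elements inside a differential BiCom-algebra -/

section Images

variable {𝕜 A C X : Type*} [Field 𝕜] [AddCommGroup A] [Module 𝕜 A] [AddCommGroup C] [Module 𝕜 C]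

/-- An associative and commutative operation embeds into a commutative monoid. -/
theorem exists_monoid_embedding.{u} {C : Type u} (op : C → C → C) (hc : ∀ x y, op x y = op y x)
    (ha : ∀ x y z, op x (op y z) = op (op x y) z) :
    ∃ (M : Type u) (_ : CommMonoid M) (i : C → M),
      Function.Injective i ∧ ∀ x y, i (op x y) = i x * i y := by
  let _ : CommSemigroup C :=
    { mul := op, mul_comm := hc, mul_assoc := fun x y z => (ha x y z).symm }
  exact ⟨WithOne C, inferInstance, WithOne.coe, WithOne.coe_injective, fun x y => rfl⟩

variable {ast nov : A →ₗ[𝕜] A →ₗ[𝕜] A} {astC odotC : C →ₗ[𝕜] C →ₗ[𝕜] C} {d : C →ₗ[𝕜] C}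
  {M : Type*} [CommMonoid M] {i : C → M} {ι : X → A} {h : A →ₗ[𝕜] C}

theorem map_foldl_odot (hi : ∀ x y, i (odotC x y) = i x * i y) (l : List C) (a : C) :
    i (l.foldl (fun x y => odotC x y) a) = i a * (l.map i).prod := by
  induction l generalizing a with
  | nil => simp
  | cons b l ih => rw [List.foldl_cons, ih, hi, List.map_cons, List.prod_cons, mul_assoc]

theorem foldl_odot_add (l : List C) (a b : C) :
    l.foldl (fun x y => odotC x y) (a + b) =
      l.foldl (fun x y => odotC x y) a + l.foldl (fun x y => odotC x y) b := by
  induction l generalizing a b with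
  | nil => rfl
  | cons c l ih => simp only [List.foldl_cons, map_add, LinearMap.add_apply, ih]

theorem IsDiffBiCom.odot_foldl (hC : IsDiffBiCom astC odotC d) (l : List C) (a b : C) :
    odotC a (l.foldl (fun x y => odotC x y) b) = l.foldl (fun x y => odotC x y) (odotC b a) := by
  induction l generalizing b with
  | nil => exact hC.odot_comm a b
  | cons c l ih =>
    rw [List.foldl_cons, List.foldl_cons, ih, ← hC.odot_assoc, ← hC.odot_assoc, hC.odot_comm c]

/-- Where a derivation exists, the formal derivative is the actual one: the subtracted term cancels
a ⊙ d(y) in d(a ⊙ y). Starting the fold at `a` avoids the need for a unit of `⊙`. -/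
theorem IsDiffBiCom.map_listDeriv (hC : IsDiffBiCom astC odotC d)
    (hh : IsHom ast nov astC (derivedNov odotC d) h) (k : ℕ) :
    ∀ (f : List A → A) (a : C),
      (∀ l, l.length = k → h (f l) = (l.map h).foldl (fun x y => odotC x y) a) →
      ∀ l, l.length = k + 1 →
        h (listDeriv nov f l) = (l.map h).foldl (fun x y => odotC x y) (d a) := by
  induction k with
  | zero =>
    intro f a hf l hl
    obtain ⟨z, rfl⟩ := List.length_eq_one_iff.1 hl
    rw [listDeriv, hh.map_nov, hf [] rfl]
    rfl
  | succ k ih =>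
    rintro f a hf (_ | ⟨y, _ | ⟨z, l⟩⟩) hl
    · simp at hl
    · simp at hl
    · have hl' : (z :: l).length = k + 1 := by simpa using hl
      rw [listDeriv, map_sub, hh.map_nov, hf _ hl',
        ih (fun l' => f (y :: l')) (odotC a (h y))
          (fun l' hl' => hf (y :: l') (by simp [hl'])) _ hl', hC.d_odot, foldl_odot_add,
        List.map_cons (l := z :: l), List.foldl_cons, derivedNov, LinearMap.comp_apply,
        hC.odot_foldl, add_sub_cancel_right]

theorem IsDiffBiCom.map_letterFun (hC : IsDiffBiCom astC odotC d)
    (hh : IsHom ast nov astC (derivedNov odotC d) h) (r : ℕ) (x : X) (l : List A)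
    (hl : l.length = r + 1) :
    h (letterFun ast nov ι (some (r, x)) l) =
      (l.map h).foldl (fun x y => odotC x y) (d^[r + 1] (h (ι x))) := by
  suffices ∀ r, ∀ l : List A, l.length = r → h ((listDeriv nov)^[r] (single0 (ι x)) l) =
      (l.map h).foldl (fun x y => odotC x y) (d^[r] (h (ι x))) from this _ l hl
  intro r
  induction r with
  | zero =>
    intro l hl
    rw [List.length_eq_zero_iff.1 hl]
    rfl
  | succ r ih =>
    rw [Function.iterate_succ_apply', Function.iterate_succ_apply']
    exact hC.map_listDeriv hh r _ _ ih

theorem IsDiffBiCom.map_normal (hC : IsDiffBiCom astC odotC d)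
    (hh : IsHom ast nov astC (derivedNov odotC d) h) (hi : ∀ x y, i (odotC x y) = i x * i y)
    {cs : List (Option (ℕ × X))} {ys : List X} {p : A} (hp : IsNormal ast nov ι cs ys p)
    (zs : List (ℕ × X)) (hcs : cs = zs.map some) :
    i (h p) = (ys.map fun y => i (h (ι y))).prod *
      (zs.map fun z => i (d^[z.1 + 1] (h (ι z.2)))).prod := by
  induction hp generalizing zs with
  | gen y =>
    rw [List.map_eq_nil_iff.1 hcs.symm]
    simp
  | letter c ys hys _ ih =>
    obtain ⟨⟨r, x⟩, zs, rfl, rfl, rfl⟩ := List.map_eq_cons_iff.1 hcs.symm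
    rw [hC.map_letterFun hh r x _ (by simp [hys, letterDeg]), map_foldl_odot hi]
    simp only [List.map_append, List.map_map, List.prod_append, List.map_cons, List.map_nil,
      List.prod_cons, List.prod_nil, mul_one, ih zs rfl]
    simp only [Function.comp_def]
    ac_rfl

end Images

/-! ### Basic monomials as normal elements -/

namespace BasicMonomial

variable {𝕜 A X : Type*} [Field 𝕜] [AddCommGroup A] [Module 𝕜 A]

/-- The letters of the derived factors of a basic monomial. -/
def letters [LinearOrder X] (m : BasicMonomial X) : List (ℕ × X) :=
  m.zs.map fun p => ((ofLex p).1 - 1, (ofLex p).2)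

/-- The element of a dual Gelfand-Dorfman algebra that corresponds to a basic monomial. -/
def value [LinearOrder X] (ast nov : A →ₗ[𝕜] A →ₗ[𝕜] A) (ι : X → A) (m : BasicMonomial X) : A :=
  m.xs.foldr (fun x w => ast (ι x) w)
    (compLetters ast nov ι (m.letters.map some) (m.ys.map ι))

/-- The weight condition read as a count of arguments: a factor of order r > 0 takes r arguments,
one of them the value of the next letter, so it uses r - 1 generators, and one more generator ends
the chain. -/
theorem length_ys [LinearOrder X] (m : BasicMonomial X) :
    m.ys.length = ((m.letters.map some).map letterDeg).sum + 1 := by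
  have key : ∀ l : List (ℕ ×ₗ X), (∀ p ∈ l, 0 < (ofLex p).1) →
      (l.map fun p => ((ofLex p).1 : ℤ)).sum =
        ((((l.map fun p => ((ofLex p).1 - 1, (ofLex p).2)).map some).map letterDeg).sum : ℕ) +
          (l.length : ℤ) := by
    intro l hl
    induction l with
    | nil => rfl
    | cons p l ih =>
      have h1 := hl p List.mem_cons_self
      have h2 := ih fun q hq => hl q (List.mem_cons_of_mem p hq)
      simp only [List.map_cons, List.sum_cons, letterDeg, List.length_cons, h2]
      push_cast [Nat.cast_sub (show 1 ≤ (ofLex p).1 from h1)]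
      ring
  have h := m.sum_eq
  rw [key m.zs m.pos] at h
  rw [letters]
  omega

theorem isNormal_foldr {ast nov : A →ₗ[𝕜] A →ₗ[𝕜] A} {ι : X → A} {cs : List (Option (ℕ × X))}
    {ys : List X} {p : A} (hp : IsNormal ast nov ι cs ys p) (xs : List X) :
    IsNormal ast nov ι (List.replicate xs.length none ++ cs) (xs ++ ys)
      (xs.foldr (fun x w => ast (ι x) w) p) := by
  induction xs with
  | nil => exact hp
  | cons x xs ih => exact IsNormal.letter none [x] rfl ih

theorem isNormal_value [LinearOrder X] (ast nov : A →ₗ[𝕜] A →ₗ[𝕜] A) (ι : X → A) (m : BasicMonomial X) :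
    IsNormal ast nov ι (List.replicate m.xs.length none ++ m.letters.map some) (m.xs ++ m.ys)
      (m.value ast nov ι) :=
  isNormal_foldr (isNormal_compLetters ast nov ι _ _ m.length_ys) m.xs

theorem perm_replicate_none {α : Type*} (cs : List (Option α)) :
    ∃ (a : ℕ) (zs : List α), cs.Perm (List.replicate a none ++ zs.map some) := by
  induction cs with
  | nil => exact ⟨0, [], List.Perm.refl _⟩
  | cons c cs ih =>
    obtain ⟨a, zs, h⟩ := ih
    rcases c with _ | z
    · exact ⟨a + 1, zs, h.cons none⟩
    · exact ⟨a, z :: zs, (h.cons _).trans List.perm_middle.symm⟩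

/-- Every normal element is the value of a basic monomial. -/
theorem _root_.GelfandDorfman.IsGDDual.exists_value_eq [LinearOrder X] {ast nov : A →ₗ[𝕜] A →ₗ[𝕜] A}
    (h : IsGDDual ast nov) {ι : X → A} {cs : List (Option (ℕ × X))} {ys : List X} {p : A}
    (hp : IsNormal ast nov ι cs ys p) : ∃ m : BasicMonomial X, m.value ast nov ι = p := by
  obtain ⟨a, zs, hcs⟩ := perm_replicate_none cs
  -- Each of the `a` letters `∗` uses one generator. After sorting, the first `a` generators become
  -- the `∗`-factors.
  have hlen : ys.length = a + (zs.map fun z => z.1).sum + 1 := by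
    rw [hp.length_eq, (hcs.map letterDeg).sum_eq]
    simp [letterDeg, Function.comp_def]
  let w := ys.insertionSort (· ≤ ·)
  have hw : w.Perm ys := List.perm_insertionSort _ _
  let zs₁ : List (ℕ ×ₗ X) := zs.map fun z => toLex (z.1 + 1, z.2)
  let zs₂ := zs₁.insertionSort (· ≤ ·)
  have hz : zs₂.Perm zs₁ := List.perm_insertionSort _ _
  have hsum : (zs₁.map fun p => ((ofLex p).1 : ℤ)).sum =
      ((zs.map fun z => z.1).sum : ℕ) + (zs.length : ℤ) := by
    simp only [zs₁, List.map_map]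
    clear * -
    induction zs with
    | nil => rfl
    | cons z zs ih => 
      simp only [List.map_cons, List.sum_cons, ih, List.length_cons, Function.comp_apply,
        ofLex_toLex]
      push_cast
      ring
  let m : BasicMonomial X :=
    { xs := w.take a
      ys := w.drop a
      zs := zs₂
      sorted := by
        rw [List.take_append_drop]
        exact List.pairwise_insertionSort _ _
      pos := fun p hp => by
        obtain ⟨z, -, rfl⟩ := List.mem_map.1 (hz.mem_iff.1 hp)
        exact Nat.succ_pos _
      sorted_lex := List.pairwise_insertionSort _ _
      sum_eq := by
        rw [(hz.map _).sum_eq, hsum, hz.length_eq, List.length_drop, hw.length_eq, hlen]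
        simp only [zs₁, List.length_map]
        omega }
  refine ⟨m, ?_⟩
  have hxs : m.xs.length = a := by
    change (w.take a).length = a
    rw [List.length_take, hw.length_eq]
    omega
  have hlet : m.letters.Perm zs := by
    have := hz.map fun p : ℕ ×ₗ X => ((ofLex p).1 - 1, (ofLex p).2)
    simp only [zs₁, List.map_map, Function.comp_def, ofLex_toLex, Nat.add_sub_cancel] at this
    exact this.trans (by simp)
  rw [(m.isNormal_value ast nov ι).eq_compLetters, hp.eq_compLetters, hxs,
    h.compLetters_perm ι (hcs.trans ((hlet.map some).symm.append_left _))]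
  refine (h.isMult_compLetters ι _).perm (List.Perm.map ι ?_)
  change (w.take a ++ w.drop a).Perm ys
  rw [List.take_append_drop]
  exact hw

theorem weight_iterate_d (r : ℕ) (x : X) :
    (DBTerm.d^[r] (DBTerm.var x)).weight = (r : ℤ) - 1 := by
  induction r with
  | zero => rfl
  | succ r ih =>
    rw [Function.iterate_succ_apply', DBTerm.weight, ih]
    push_cast
    ring

theorem weight_odotProd : ∀ (l : List (DBTerm X)) (hl : l ≠ []),
    (odotProd l hl).weight = (l.map DBTerm.weight).sum
  | [], hl => absurd rfl hl
  | [s], _ => by simp [odotProd]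
  | s :: t :: l, _ => by
    rw [odotProd, DBTerm.weight, weight_odotProd (t :: l), List.map_cons (l := t :: l),
      List.sum_cons]

theorem weight_toTerm [LinearOrder X] (m : BasicMonomial X) : m.toTerm.weight = -1 := by
  have h1 : (odotProd m.factors m.factors_ne_nil).weight = -1 := by
    rw [weight_odotProd, ← m.sum_eq, factors]
    have hy : ∀ l : List X, ((l.map DBTerm.var).map DBTerm.weight).sum = -(l.length : ℤ) := by
      intro l
      induction l with
      | nil => rfl
      | cons x l ih =>
        simp only [List.map_cons, List.sum_cons, ih, DBTerm.weight, List.length_cons]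
        push_cast
        ring
    have hz : ∀ l : List (ℕ ×ₗ X),
        ((l.map fun p => DBTerm.d^[(ofLex p).1] (DBTerm.var (ofLex p).2)).map
          DBTerm.weight).sum = (l.map fun p => ((ofLex p).1 : ℤ)).sum - l.length := by
      intro l
      induction l with
      | nil => rfl
      | cons x l ih =>
        simp only [List.map_cons, List.sum_cons, ih, weight_iterate_d, List.length_cons]
        push_cast
        ring
    rw [List.map_append, List.sum_append, hy, hz]
    push_cast
    ring
  rw [toTerm]
  induction m.xs with
  | nil => exact h1
  | cons x xs ih => rw [List.foldr_cons, DBTerm.weight, ih]; rfl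

theorem ofTerm_iterate_d (r : ℕ) (x : X) :
    FreeDiffBiCom.ofTerm 𝕜 (DBTerm.d^[r] (DBTerm.var x)) =
      FreeDiffBiCom.d^[r] (FreeDiffBiCom.ι x) := by
  induction r with
  | zero => rfl
  | succ r ih =>
    rw [Function.iterate_succ_apply', Function.iterate_succ_apply', FreeDiffBiCom.ofTerm_d, ih]

theorem map_ofTerm_odotProd {M : Type*} [CommMonoid M] {i : FreeDiffBiCom 𝕜 X → M}
    (hi : ∀ x y, i (FreeDiffBiCom.odot x y) = i x * i y) : ∀ (l : List (DBTerm X)) (hl : l ≠ []),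
    i (FreeDiffBiCom.ofTerm 𝕜 (odotProd l hl)) =
      (l.map fun t => i (FreeDiffBiCom.ofTerm 𝕜 t)).prod
  | [], hl => absurd rfl hl
  | [s], _ => by simp [odotProd]
  | s :: t :: l, _ => by
    rw [odotProd, FreeDiffBiCom.ofTerm_odot, hi, map_ofTerm_odotProd hi (t :: l),
      List.map_cons (l := t :: l), List.prod_cons]

theorem map_value [LinearOrder X] {ast nov : A →ₗ[𝕜] A →ₗ[𝕜] A} {ι : X → A} {h : A →ₗ[𝕜] FreeDiffBiCom 𝕜 X}
    (hh : IsHom ast nov FreeDiffBiCom.ast (derivedNov FreeDiffBiCom.odot FreeDiffBiCom.d) h)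
    (hι : ∀ x, h (ι x) = FreeDiffBiCom.ι x) (m : BasicMonomial X) :
    h (m.value ast nov ι) = FreeDiffBiCom.ofTerm 𝕜 m.toTerm := by
  have hC := FreeDiffBiCom.isDiffBiCom (𝕜 := 𝕜) (X := X)
  rw [value, toTerm]
  induction m.xs with
  | nil =>
    -- In a commutative monoid both nested `⊙`-products become `List.prod`, which is insensitive to
    -- bracketing and defined also when there are no derived factors.
    obtain ⟨M, _, i, hinj, hi⟩ := exists_monoid_embedding
      (fun x y : FreeDiffBiCom 𝕜 X => FreeDiffBiCom.odot x y) hC.odot_comm hC.odot_assoc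
    apply hinj
    simp only [List.foldr_nil]
    rw [map_ofTerm_odotProd hi, hC.map_normal hh hi
      (isNormal_compLetters ast nov ι _ _ m.length_ys) m.letters rfl, factors, List.map_append,
      List.prod_append, letters]
    simp only [List.map_map, hι]
    congr 2
    refine List.map_congr_left fun p hp => ?_
    simp only [Function.comp_apply, ofTerm_iterate_d]
    rw [Nat.sub_add_cancel (m.pos p hp)]
  | cons x xs ih =>
    simp only [List.foldr_cons]
    rw [hh.map_ast, ih, hι, FreeDiffBiCom.ofTerm_ast]
    rfl

/-- The multiset of all differential letters of a basic monomial. -/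
def content [LinearOrder X] (m : BasicMonomial X) : Multiset (ℕ × X) :=
  (((m.xs ++ m.ys).map fun x => (0, x)) ++ m.zs.map ofLex : List (ℕ × X))

/-- The content forgets where `∗` stops and `⊙` begins. Order zero separates the underived letters
from the rest, sorting recovers both lists, and the weight condition places the cut. -/
theorem content_injective [LinearOrder X] : Function.Injective (content (X := X)) := by
  intro m m' hm
  have hperm := Multiset.coe_eq_coe.1 hm
  have hx : ∀ l : List X, (l.map fun x => (0, x)).filter (fun p : ℕ × X => p.1 = 0) =
      l.map fun x => (0, x) := fun l => List.filter_eq_self.2 (by simp)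
  have hx' : ∀ l : List X, (l.map fun x => (0, x)).filter (fun p : ℕ × X => p.1 ≠ 0) = [] :=
    fun l => List.filter_eq_nil_iff.2 (by simp)
  have hz : ∀ m : BasicMonomial X, (m.zs.map ofLex).filter (fun p : ℕ × X => p.1 = 0) = [] := by
    refine fun m => List.filter_eq_nil_iff.2 fun p hp => ?_
    obtain ⟨q, hq, rfl⟩ := List.mem_map.1 hp
    simpa using (m.pos q hq).ne'
  have hz' : ∀ m : BasicMonomial X, (m.zs.map ofLex).filter (fun p : ℕ × X => p.1 ≠ 0) =
      m.zs.map ofLex := by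
    refine fun m => List.filter_eq_self.2 fun p hp => ?_
    obtain ⟨q, hq, rfl⟩ := List.mem_map.1 hp
    simpa using (m.pos q hq).ne'
  have h1 := hperm.filter fun p : ℕ × X => p.1 = 0
  have h2 := hperm.filter fun p : ℕ × X => p.1 ≠ 0
  rw [List.filter_append, List.filter_append, hx, hx, hz, hz, List.append_nil,
    List.append_nil] at h1
  rw [List.filter_append, List.filter_append, hx', hx', hz', hz', List.nil_append,
    List.nil_append] at h2
  have e1 : m.xs ++ m.ys = m'.xs ++ m'.ys := by
    refine List.Perm.eq_of_pairwise' m.sorted m'.sorted ?_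
    simpa [Function.comp_def] using h1.map Prod.snd
  have e2 : m.zs = m'.zs := by
    refine List.Perm.eq_of_pairwise' m.sorted_lex m'.sorted_lex ?_
    simpa [Function.comp_def] using h2.map toLex
  -- The number of underived `⊙`-factors depends only on `zs`.
  have e3 : m.ys.length = m'.ys.length := by
    rw [m.length_ys, m'.length_ys, letters, letters, e2]
  obtain ⟨e4, e5⟩ := List.append_inj' e1 e3
  exact BasicMonomial.ext e4 e5 e2

/-! ### Linear independence in differential polynomials -/

variable (𝕜 X) in
/-- The derivation of the polynomial algebra in the variables `d^r(x)`. -/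
noncomputable def polyDeriv : Derivation 𝕜 (MvPolynomial (ℕ × X) 𝕜) (MvPolynomial (ℕ × X) 𝕜) :=
  MvPolynomial.mkDerivation 𝕜 fun p => MvPolynomial.X (p.1 + 1, p.2)

theorem isDiffBiCom_polynomial : IsDiffBiCom (LinearMap.mul 𝕜 (MvPolynomial (ℕ × X) 𝕜))
    (LinearMap.mul 𝕜 (MvPolynomial (ℕ × X) 𝕜)) (polyDeriv 𝕜 X).toLinearMap where
  ast_comm := mul_comm
  ast_assoc x y z := (mul_assoc x y z).symm
  odot_comm := mul_comm
  odot_assoc x y z := (mul_assoc x y z).symm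
  mixed := mul_assoc
  d_ast x y := ((polyDeriv 𝕜 X).leibniz x y).trans (by
    change x * polyDeriv 𝕜 X y + y * polyDeriv 𝕜 X x = polyDeriv 𝕜 X x * y + x * polyDeriv 𝕜 X y
    ring)
  d_odot x y := ((polyDeriv 𝕜 X).leibniz x y).trans (by
    change x * polyDeriv 𝕜 X y + y * polyDeriv 𝕜 X x = polyDeriv 𝕜 X x * y + x * polyDeriv 𝕜 X y
    ring)

/-- The value of a differential monomial in the polynomial algebra. -/
noncomputable def polyEval (𝕜 : Type*) [Field 𝕜] (t : DBTerm X) : MvPolynomial (ℕ × X) 𝕜 :=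
  t.eval (LinearMap.mul 𝕜 _) (LinearMap.mul 𝕜 _) (polyDeriv 𝕜 X).toLinearMap
    fun x => MvPolynomial.X (0, x)

theorem polyEval_d (s : DBTerm X) : polyEval 𝕜 (.d s) = polyDeriv 𝕜 X (polyEval 𝕜 s) := rfl

theorem polyEval_ast (s t : DBTerm X) :
    polyEval 𝕜 (.ast s t) = polyEval 𝕜 s * polyEval 𝕜 t := rfl

theorem polyEval_odot (s t : DBTerm X) :
    polyEval 𝕜 (.odot s t) = polyEval 𝕜 s * polyEval 𝕜 t := rfl

theorem polyEval_iterate_d (r : ℕ) (x : X) :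
    polyEval 𝕜 (DBTerm.d^[r] (DBTerm.var x)) = MvPolynomial.X (r, x) := by
  induction r with
  | zero => rfl
  | succ r ih =>
    rw [Function.iterate_succ_apply', polyEval_d, ih]
    exact MvPolynomial.mkDerivation_X _ _ _

theorem polyEval_odotProd : ∀ (l : List (DBTerm X)) (hl : l ≠ []),
    polyEval 𝕜 (odotProd l hl) = (l.map (polyEval 𝕜)).prod
  | [], hl => absurd rfl hl
  | [s], _ => by simp [odotProd]
  | s :: t :: l, _ => by
    rw [odotProd, polyEval_odot, polyEval_odotProd (t :: l), List.map_cons (l := t :: l),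
      List.prod_cons]

theorem prod_map_X {σ : Type*} [DecidableEq σ] (s : Multiset σ) :
    (s.map MvPolynomial.X).prod = MvPolynomial.monomial (R := 𝕜) (Multiset.toFinsupp s) 1 := by
  induction s using Multiset.induction with
  | empty => simp
  | cons a s ih =>
    rw [Multiset.map_cons, Multiset.prod_cons, ih, MvPolynomial.X, MvPolynomial.monomial_mul,
      ← Multiset.singleton_add, Multiset.toFinsupp_add, Multiset.toFinsupp_singleton, mul_one]

theorem polyEval_toTerm [LinearOrder X] (m : BasicMonomial X) :
    polyEval 𝕜 m.toTerm = MvPolynomial.monomial (Multiset.toFinsupp m.content) 1 := by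
  have key : ∀ (xs : List X) (t : DBTerm X),
      polyEval 𝕜 (xs.foldr (fun x w => DBTerm.ast (DBTerm.var x) w) t) =
        (xs.map fun x => MvPolynomial.X (0, x)).prod * polyEval 𝕜 t := by
    intro xs t
    induction xs with
    | nil => simp
    | cons x xs ih =>
      rw [List.foldr_cons, polyEval_ast, ih, List.map_cons, List.prod_cons, mul_assoc]
      rfl
  rw [← prod_map_X, toTerm, key, polyEval_odotProd, content, factors]
  simp only [Multiset.map_coe, Multiset.prod_coe, List.map_append, List.prod_append,
    List.map_map, mul_assoc]
  congr 3
  exact List.map_congr_left fun p _ => polyEval_iterate_d _ _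

theorem linearIndependent_ofTerm [LinearOrder X] :
    LinearIndependent 𝕜 fun m : BasicMonomial X => FreeDiffBiCom.ofTerm 𝕜 m.toTerm := by
  obtain ⟨g, hg⟩ := FreeDiffBiCom.exists_lift (isDiffBiCom_polynomial (𝕜 := 𝕜) (X := X))
    fun x => MvPolynomial.X (0, x)
  refine LinearIndependent.of_comp g ?_
  have e : (g ∘ fun m : BasicMonomial X => FreeDiffBiCom.ofTerm 𝕜 m.toTerm) =
      MvPolynomial.basisMonomials (ℕ × X) 𝕜 ∘ fun m => Multiset.toFinsupp m.content := by
    funext m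
    rw [Function.comp_apply, hg, Function.comp_apply, MvPolynomial.coe_basisMonomials]
    exact polyEval_toTerm m
  rw [e]
  exact (MvPolynomial.basisMonomials (ℕ × X) 𝕜).linearIndependent.comp _
    (Multiset.toFinsupp.injective.comp content_injective)

end BasicMonomial

end GelfandDorfman

/-! ### The isomorphism, the basis and freeness -/

open GelfandDorfman in
theorem mainTheorem5 (𝕜 : Type*) [Field 𝕜] (X : Type*) [LinearOrder X] :
    -- the subalgebra generated by `X` is the free algebra of the variety of special algebras
    (IsSGDDual (SGDDual.ast (𝕜 := 𝕜) (X := X)) SGDDual.nov ∧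
      ∀ (B : Type*) [AddCommGroup B] [Module 𝕜 B] (astB novB : B →ₗ[𝕜] B →ₗ[𝕜] B),
        IsSGDDual astB novB → ∀ f : X → B, ∃! g : SGDDual 𝕜 X →ₗ[𝕜] B,
          IsHom SGDDual.ast SGDDual.nov astB novB g ∧ ∀ x, g (SGDDual.ι x) = f x) ∧
    -- it is isomorphic to the free dual Gelfand-Dorfman algebra, compatibly with generators
    ∃ e : FreeGDDual 𝕜 X ≃ₗ[𝕜] SGDDual 𝕜 X,
      IsHom FreeGDDual.ast FreeGDDual.nov SGDDual.ast SGDDual.nov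
        (e : FreeGDDual 𝕜 X →ₗ[𝕜] SGDDual 𝕜 X) ∧
      (∀ x, e (FreeGDDual.ι x) = SGDDual.ι x) ∧
      -- the basic monomials have weight `-1` and form a linear basis
      (∀ m : BasicMonomial X, m.toTerm.weight = -1) ∧
      ∃ b : Module.Basis (BasicMonomial X) 𝕜 (FreeGDDual 𝕜 X),
        ∀ m, (e (b m) : FreeDiffBiCom 𝕜 X) = FreeDiffBiCom.ofTerm 𝕜 m.toTerm := by
  have hF := FreeGDDual.isGDDual (𝕜 := 𝕜) (X := X)
  obtain ⟨φ, hφ, hφι⟩ := FreeGDDual.exists_lift (SGDDual.isGDDual (𝕜 := 𝕜) (X := X)) SGDDual.ι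
  have hval : ∀ m : BasicMonomial X, (SGDDual 𝕜 X).subtype
      (φ (m.value FreeGDDual.ast FreeGDDual.nov FreeGDDual.ι)) =
        FreeDiffBiCom.ofTerm 𝕜 m.toTerm := by
    refine fun m => BasicMonomial.map_value (h := (SGDDual 𝕜 X).subtype ∘ₗ φ) ⟨?_, ?_⟩ ?_ m
    · exact fun x y => congrArg Subtype.val (hφ.map_ast x y)
    · exact fun x y => congrArg Subtype.val (hφ.map_nov x y)
    · exact fun x => congrArg Subtype.val (hφι x)
  have hli : LinearIndependent 𝕜 fun m : BasicMonomial X =>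
      (m.value FreeGDDual.ast FreeGDDual.nov FreeGDDual.ι : FreeGDDual 𝕜 X) := by
    refine LinearIndependent.of_comp ((SGDDual 𝕜 X).subtype ∘ₗ φ) ?_
    have e : (((SGDDual 𝕜 X).subtype ∘ₗ φ) ∘ fun m : BasicMonomial X =>
        m.value FreeGDDual.ast FreeGDDual.nov FreeGDDual.ι) =
          fun m => FreeDiffBiCom.ofTerm 𝕜 m.toTerm := funext hval
    rw [e]
    exact BasicMonomial.linearIndependent_ofTerm
  have hspan : ⊤ ≤ Submodule.span 𝕜 (Set.range fun m : BasicMonomial X =>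
      (m.value FreeGDDual.ast FreeGDDual.nov FreeGDDual.ι : FreeGDDual 𝕜 X)) := by
    rw [← FreeGDDual.eq_top_of_closed (S := normalSpan FreeGDDual.ast FreeGDDual.nov FreeGDDual.ι)
      (fun x => (IsNormal.gen x).mem_normalSpan) (fun a ha b hb => hF.ast_mem_normalSpan ha hb)
      (fun a ha b hb => hF.nov_mem_normalSpan ha hb)]
    exact Submodule.span_mono fun p ⟨cs, ys, hp⟩ => hF.exists_value_eq hp
  let b := Module.Basis.mk hli hspan
  have hb : ∀ m, b m = m.value FreeGDDual.ast FreeGDDual.nov FreeGDDual.ι :=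
    fun m => Module.Basis.mk_apply hli hspan m
  have hinj : Function.Injective φ := by
    -- In coordinates with respect to `b`, the map `φ` is the linear combination map of an
    -- independent family, hence injective.
    have e : Finsupp.linearCombination 𝕜 (fun m : BasicMonomial X =>
        FreeDiffBiCom.ofTerm 𝕜 m.toTerm) ∘ₗ b.repr.toLinearMap =
          (SGDDual 𝕜 X).subtype ∘ₗ φ := by
      refine b.ext fun m => ?_
      rw [LinearMap.comp_apply, LinearEquiv.coe_coe, b.repr_self,
        Finsupp.linearCombination_single, one_smul, hb]
      exact (hval m).symm
    refine Function.Injective.of_comp (f := (SGDDual 𝕜 X).subtype) ?_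
    rw [← LinearMap.coe_comp, ← e, LinearMap.coe_comp]
    exact Function.Injective.comp (BasicMonomial.linearIndependent_ofTerm (𝕜 := 𝕜) (X := X)) b.repr.injective
  have hsurj : Function.Surjective φ := by
    refine LinearMap.range_eq_top.1 (SGDDual.eq_top_of_closed (fun x => ⟨_, hφι x⟩) ?_ ?_)
    · rintro _ ⟨x, rfl⟩ _ ⟨y, rfl⟩
      exact ⟨_, hφ.map_ast x y⟩
    · rintro _ ⟨x, rfl⟩ _ ⟨y, rfl⟩
      exact ⟨_, hφ.map_nov x y⟩
  let e := LinearEquiv.ofBijective φ ⟨hinj, hsurj⟩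
  refine ⟨⟨SGDDual.isSGDDual, fun B _ _ astB novB hB f => ?_⟩, e, ⟨hφ.map_ast, hφ.map_nov⟩, hφι,
    BasicMonomial.weight_toTerm, b, fun m => ?_⟩
  -- An algebra of the special variety is in particular dual Gelfand-Dorfman, so the lift from the
  -- free such algebra exists and is transported along `e`.
  · obtain ⟨g, hg, hgι⟩ := FreeGDDual.exists_lift hB.isGDDual f
    have he : ∀ x, e.symm (φ x) = x := e.symm_apply_apply
    have hgs : IsHom SGDDual.ast SGDDual.nov astB novB (g ∘ₗ e.symm.toLinearMap) := by
      constructor <;> refine hsurj.forall₂.2 fun x y => ?_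
      · simp only [LinearMap.comp_apply, LinearEquiv.coe_coe, ← hφ.map_ast, he, hg.map_ast]
      · simp only [LinearMap.comp_apply, LinearEquiv.coe_coe, ← hφ.map_nov, he, hg.map_nov]
    have hgsι : ∀ x, (g ∘ₗ e.symm.toLinearMap) (SGDDual.ι x) = f x := fun x => by
      rw [← hφι, LinearMap.comp_apply, LinearEquiv.coe_coe, he, hgι]
    exact ⟨_, ⟨hgs, hgsι⟩, fun g' hg' =>
      SGDDual.hom_ext hg'.1 hgs fun x => (hg'.2 x).trans (hgsι x).symm⟩
  · rw [hb]
    exact hval m
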